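/- **Setting.** Let $R$ be a complete discrete valuation ring with uniformizer $s$, fraction field $K$, residue field $k(0)$ and normalized valuation $v_s$; let $S=\operatorname{Spec}R$, and write $Z_0$ for the closed fibre of an $S$-scheme $Z$. Let $X$ be a free $\mathbb Z$-module of finite rank, $X^\vee=\operatorname{Hom}(X,\mathbb Z)$, $X_{\mathbb R}=X\otimes\mathbb R$, and let $K[X]$ be the group ring with monomials $w^x$ ($x\in X$). Let $Y\subseteq X$ be a subgroup of finite index, $a:Y\to K^\times$ a function with $a(0)=1$ and $a(-y)=a(y)$, and $b:Y\times X\to K^\times$ a bilinear function with $b(y,z)=a(y+z)a(y)^{-1}a(z)^{-1}$ for $y,z\in Y$, such that $B:=v_s\circ b$ is symmetric and positive definite on $Y\times Y$. Let $\beta_0:Y\to X^\vee$, $\beta_0(y)(x)=B(y,x)$, let $N=|X^\vee/\beta_0(Y)|$, and let $\phi=\beta_0^{-1}\circ(N\cdot\mathrm{id}):X^\vee\to Y$. Let $b^e:X^\vee\times X\to K^\times$ be a bilinear function with $b^e(\beta_0(y),x)=b(y,x)$. Put $\epsilon(v)=b^e(v,\phi(v))$. Extend $B$ to a bilinear form on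 $X_{\mathbb R}$ and put $\|z\|=\sqrt{B(z,z)}$. Let $l\ge 1$ be an integer, $E_l(v)=l\,v_s(\epsilon(v))$, $\Sigma_l=\{\alpha\in X:\ E_l(v)+v(\alpha)\ge 0\ \ \forall v\in X^\vee\}$, and $\Sigma_l(0)=\{x\in X_{\mathbb R}:\ \|x\|\le\|x-2l\phi(v)\|\ \ \forall v\in X^\vee\}$. Assume that $\Sigma_l(0)$ is integral: it is the convex hull of $\Sigma_l(0)\cap X$, it is symmetric and contains $0$, and $\Sigma_l(0)\cap X$ contains a basis of $X$. For $\alpha\in\Sigma_l$ and $u\in X^\vee$ put $\xi_{l,\alpha,u}=\epsilon(u)^l\,b^e(u,\alpha)\,w^{\alpha+2l\phi(u)}\in K[X]$. Let $A_{l,\alpha,u}=R[\xi_{l,\gamma,v}/\xi_{l,\alpha,u}:\gamma\in\Sigma_l,\ v\in X^\vee]\subseteq K[X]$, let $B_{l,\alpha,u}$ be its normalization, that is, its integral closure in $K[X]$, and let $W_{l,\alpha,u}=\operatorname{Spec}B_{l,\alpha,u}$. These charts are glued along their common generic fibre $\operatorname{Spec}K[X]$: an equality $W_{l,\alpha,u}=W_{l,\alpha',u'}$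 means $B_{l,\alpha,u}=B_{l,\alpha',u'}$ in $K[X]$, and $W_{l,\alpha',u'}$ is regarded as an open subscheme of $W_{l,\alpha,u}$ if $B_{l,\alpha,u}\subseteq B_{l,\alpha',u'}$ and this inclusion induces an open immersion. For $v\in X^\vee$ let $\delta_v$ be the translation given by $\delta_v^*(w^x)=b^e(v,x)w^x$. For $\beta\in\Sigma_l$ let $\operatorname{Cone}(C_l^\beta)=\sum_{\gamma\in\Sigma_l}\mathbb R_{\ge0}(\gamma-\beta)\subseteq X_{\mathbb R}$. Let $\Sigma_l^\alpha=(\alpha+2l\phi(X^\vee))\cap\Sigma_l$, and for $\beta\in\Sigma_l^\alpha$ let $v_\beta\in X^\vee$ be the unique element with $\beta=\alpha-2l\phi(v_\beta)$. **Theorem.** Let $\alpha\in\Sigma_l$ and $u\in X^\vee$. 1. If $\alpha$ lies in the relative interior of $\Sigma_l(0)$, then $W_{l,\alpha,u}=W_{l,0,u}=\operatorname{Spec}R[s^{u(x)}w^x:\ x\in X]$, and this is isomorphic over $S$ to the split torus $T_{X,R}=\operatorname{Spec}R[X]$. 2. If $\alpha$ lies on the boundary of $\Sigma_l(0)$, then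 for every $\beta\in\Sigma_l^\alpha$ the chart $W_{l,0,v_\beta+u}$ is an open subscheme of $W_{l,\alpha,u}$, its closed fibre is an open subscheme of $(W_{l,\alpha,u})_0$, and $(W_{l,0,v_\beta+u})_0=\delta_{-v_\beta}\big((W_{l,0,u})_0\big)$, where $\delta_{-v_\beta}$ maps $(W_{l,\beta,u})_0\supseteq(W_{l,0,u})_0$ to $(W_{l,\alpha,u})_0$. The irreducible components of $(W_{l,\alpha,u})_0$ are exactly the closures in $(W_{l,\alpha,u})_0$ of the $(W_{l,0,v_\beta+u})_0$, $\beta\in\Sigma_l^\alpha$. 3. If $\alpha$ lies on the boundary of $\Sigma_l(0)$, then the monomials $s^{(v_\beta+u)(x)}w^x$ with $\beta\in\Sigma_l^\alpha$ and $x\in\operatorname{Cone}(C_l^\beta)\cap X$ lie in $B_{l,\alpha,u}$, and their images generate the $k(0)$-algebra $B_{l,\alpha,u}\otimes_Rk(0)$. For $\beta',\beta''\in\Sigma_l^\alpha$, $x\in\operatorname{Cone}(C_l^{\beta'})\cap X$ and $y\in\operatorname{Cone}(C_l^{\beta''})\cap X$ one has in $B_{l,\alpha,u}\otimes_Rk(0)$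 $$s^{(v_{\beta'}+u)(x)}w^x\cdot s^{(v_{\beta''}+u)(y)}w^y=\begin{cases}s^{(v_\beta+u)(x+y)}w^{x+y}&\text{if }x,y\in\operatorname{Cone}(C_l^\beta)\text{ for some }\beta\in\Sigma_l^\alpha,\\0&\text{otherwise,}\end{cases}$$ where in the first case the formula holds for every such $\beta$. The product is nonzero exactly in the first case. Together with $s^0w^0=1$ these are defining relations: they generate the ideal of all polynomial relations over $k(0)$ among the generators. -/

import Mathlib

open scoped TensorProduct
open CategoryTheory AlgebraicGeometry

universe u

namespace NeronModel

/-- The normalized valuation `v_s` of the fraction field `K` of the discrete valuation ring `R`: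
the additive form of the `𝔪`-adic valuation, so that a uniformizer has value `1`. -/
noncomputable def vs (R : Type u) {K : Type u} [CommRing R] [IsDomain R]
    [IsDiscreteValuationRing R] [Field K] [Algebra R K] [IsFractionRing R K] (z : Kˣ) : ℤ :=
  -WithZero.log ((IsDiscreteValuationRing.maximalIdeal R).valuation K (z : K))

theorem vs_mul (R : Type u) {K : Type u} [CommRing R] [IsDomain R]
    [IsDiscreteValuationRing R] [Field K] [Algebra R K] [IsFractionRing R K] (z w : Kˣ) :
    vs R (z * w) = vs R z + vs R w := by
  have hz : (IsDiscreteValuationRing.maximalIdeal R).valuation K (z : K) ≠ 0 := by simp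
  have hw : (IsDiscreteValuationRing.maximalIdeal R).valuation K (w : K) ≠ 0 := by simp
  simp only [vs, Units.val_mul, map_mul, WithZero.log_mul hz hw]
  ring

/-- The real vector space `X_ℝ = ℝ ⊗ X`. -/
abbrev XR (X : Type u) [AddCommGroup X] : Type u := ℝ ⊗[ℤ] X

/-- `X_ℝ` carries its canonical topology as an `ℝ`-module
(the usual topology when `X` is finitely generated). -/
noncomputable instance instTopologicalSpaceXR (X : Type u) [AddCommGroup X] : TopologicalSpace (XR X) :=
  moduleTopology ℝ (XR X)

/-- The canonical map `X → X_ℝ`. -/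
noncomputable def toXR {X : Type u} [AddCommGroup X] (x : X) : XR X := (1 : ℝ) ⊗ₜ[ℤ] x

/-- A (totally degenerate) Faltings-Chai degeneration datum `(a, b, A, B, X, Y)` over `R`, where
`A = v_s ∘ a` and `B = v_s ∘ b`. -/
structure FCDatum (R K X : Type u) [CommRing R] [IsDomain R] [IsDiscreteValuationRing R]
    [Field K] [Algebra R K] [IsFractionRing R K] [AddCommGroup X] where
  /-- the submodule `Y` of finite index of `X` -/
  Y : AddSubgroup X
  finiteIndex : Y.FiniteIndex
  a : Y → Kˣ
  b : Y → X → Kˣ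
  b_add_left : ∀ y z x, b (y + z) x = b y x * b z x
  b_add_right : ∀ y x x', b y (x + x') = b y x * b y x'
  a_zero : a 0 = 1
  b_eq : ∀ y z : Y, b y (z : X) = a (y + z) * (a y)⁻¹ * (a z)⁻¹
  B_symm : ∀ y z : Y, vs R (b y (z : X)) = vs R (b z (y : X))
  B_pos : ∀ y : Y, y ≠ 0 → 0 < vs R (b y (y : X))

namespace FCDatum

variable {R K X : Type u} [CommRing R] [IsDomain R] [IsDiscreteValuationRing R]
  [Field K] [Algebra R K] [IsFractionRing R K] [AddCommGroup X]

/-- The datum is exact if `a` is even. -/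
def IsExact (ξ : FCDatum R K X) : Prop := ∀ y, ξ.a (-y) = ξ.a y

/-- The pairing `B = v_s ∘ b : Y × X → ℤ`. -/
noncomputable def B (ξ : FCDatum R K X) (y : ξ.Y) (x : X) : ℤ := vs R (ξ.b y x)

theorem B_add_left (ξ : FCDatum R K X) (y z : ξ.Y) (x : X) :
    ξ.B (y + z) x = ξ.B y x + ξ.B z x := by
  simp only [B, ξ.b_add_left, vs_mul]

theorem B_add_right (ξ : FCDatum R K X) (y : ξ.Y) (x x' : X) :
    ξ.B y (x + x') = ξ.B y x + ξ.B y x' := by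
  simp only [B, ξ.b_add_right, vs_mul]

/-- The homomorphism `β : Y → X^∨`, `β(y)(x) = B(y, x)`. -/
noncomputable def beta (ξ : FCDatum R K X) : ξ.Y →ₗ[ℤ] Module.Dual ℤ X :=
  AddMonoidHom.toIntLinearMap
    (AddMonoidHom.mk'
      (fun y => AddMonoidHom.toIntLinearMap (AddMonoidHom.mk' (fun x => ξ.B y x) (ξ.B_add_right y)))
      (fun y z => by ext x; exact ξ.B_add_left y z x))

@[simp] theorem beta_apply (ξ : FCDatum R K X) (y : ξ.Y) (x : X) : ξ.beta y x = ξ.B y x := rfl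

theorem beta_injective (ξ : FCDatum R K X) : Function.Injective ξ.beta := by
  rw [injective_iff_map_eq_zero]
  intro y hy
  by_contra h
  have h1 := ξ.B_pos y h
  have h2 : ξ.beta y (y : X) = 0 := by rw [hy]; rfl
  rw [beta_apply, B] at h2
  omega

/-- `N = |X^∨ / β(Y)|`. -/
noncomputable def N (ξ : FCDatum R K X) : ℕ :=
  Nat.card (Module.Dual ℤ X ⧸ LinearMap.range ξ.beta)

theorem N_smul_mem (ξ : FCDatum R K X) (v : Module.Dual ℤ X) :
    ξ.N • v ∈ LinearMap.range ξ.beta := by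
  rw [← Submodule.Quotient.mk_eq_zero, Submodule.Quotient.mk_smul]
  exact card_nsmul_eq_zero'

/-- `φ = β⁻¹ ∘ (N · id) : X^∨ → Y`. -/
noncomputable def phi (ξ : FCDatum R K X) : Module.Dual ℤ X →ₗ[ℤ] ξ.Y :=
  (LinearEquiv.ofInjective ξ.beta ξ.beta_injective).symm.toLinearMap ∘ₗ
    LinearMap.codRestrict (LinearMap.range ξ.beta)
      (ξ.N • (LinearMap.id : Module.Dual ℤ X →ₗ[ℤ] Module.Dual ℤ X)) ξ.N_smul_mem

theorem beta_phi (ξ : FCDatum R K X) (v : Module.Dual ℤ X) : ξ.beta (ξ.phi v) = ξ.N • v := by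
  have h := LinearEquiv.apply_symm_apply (LinearEquiv.ofInjective ξ.beta ξ.beta_injective)
    (LinearMap.codRestrict (LinearMap.range ξ.beta)
      (ξ.N • (LinearMap.id : Module.Dual ℤ X →ₗ[ℤ] Module.Dual ℤ X)) ξ.N_smul_mem v)
  exact congrArg Subtype.val h

theorem index_smul_mem (ξ : FCDatum R K X) (x : X) : ξ.Y.index • x ∈ ξ.Y := by
  rw [← QuotientAddGroup.eq_zero_iff, QuotientAddGroup.mk_nsmul, AddSubgroup.index_eq_card]
  exact card_nsmul_eq_zero'

/-- Multiplication by the index of `Y`, as a map `X → Y`. -/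
noncomputable def indexMul (ξ : FCDatum R K X) : X →+ ξ.Y :=
  AddMonoidHom.mk' (fun x => ⟨ξ.Y.index • x, ξ.index_smul_mem x⟩)
    (fun _ _ => Subtype.ext (smul_add _ _ _))

/-- The integral bilinear form `(x, x') ↦ B([X : Y] x, x')` on `X`. -/
noncomputable def BInt (ξ : FCDatum R K X) : LinearMap.BilinForm ℤ X :=
  AddMonoidHom.toIntLinearMap (ξ.beta.toAddMonoidHom.comp ξ.indexMul)

/-- The real bilinear form on `X_ℝ` extending `B` on `Y × X`. -/
noncomputable def BR (ξ : FCDatum R K X) : LinearMap.BilinForm ℝ (XR X) :=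
  ((ξ.Y.index : ℝ)⁻¹) • LinearMap.BilinForm.baseChange ℝ ξ.BInt

theorem BR_toXR (ξ : FCDatum R K X) (y : ξ.Y) (x : X) :
    ξ.BR (toXR (y : X)) (toXR x) = ξ.B y x := by
  have h0 : (ξ.Y.index : ℝ) ≠ 0 := Nat.cast_ne_zero.mpr ξ.finiteIndex.index_ne_zero
  have h1 : ξ.indexMul (y : X) = ξ.Y.index • y := Subtype.ext rfl
  have h2 : ξ.BInt (y : X) x = ξ.Y.index • ξ.B y x := by
    change ξ.beta (ξ.indexMul (y : X)) x = _
    rw [h1, map_nsmul]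
    rfl
  simp only [BR, toXR, LinearMap.smul_apply, LinearMap.BilinForm.baseChange_tmul, h2]
  simp [h0]

/-- The length `‖z‖ = √B(z, z)` on `X_ℝ`. -/
noncomputable def len (ξ : FCDatum R K X) (z : XR X) : ℝ := Real.sqrt (ξ.BR z z)

/-- The Voronoi polytope `Σ_l(c)`: the points of `X_ℝ` to which `2lφ(c)` is nearest among the
points of `2lφ(X^∨)`. -/
def voronoi (ξ : FCDatum R K X) (l : ℕ) (c : Module.Dual ℤ X) : Set (XR X) :=
  {x | ∀ v : Module.Dual ℤ X,
    ξ.len (x - toXR ((2 * l) • (ξ.phi c : X))) ≤ ξ.len (x - toXR ((2 * l) • (ξ.phi v : X)))}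

end FCDatum

/-- A subset `Δ` of `X_ℝ` is integral if `Δ = Conv(Δ ∩ X)`, `Δ = -Δ ∋ 0`, and `Δ ∩ X` contains a
`ℤ`-basis of `X`. -/
def IsIntegralPolytope {X : Type u} [AddCommGroup X] (Δ : Set (XR X)) : Prop :=
  Δ = convexHull ℝ (Δ ∩ Set.range toXR) ∧ (∀ z ∈ Δ, -z ∈ Δ) ∧ (0 : XR X) ∈ Δ ∧
    ∃ (ι : Type u) (e : Module.Basis ι ℤ X), ∀ i, toXR (e i) ∈ Δ

/-- An extended Faltings-Chai datum: a datum `(a, b, A, B, X, Y)` with a bilinear function `b^e` on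
`X^∨ × X` such that `b(y, x) = b^e(β(y), x)`.
All other members of the Néron-Faltings-Chai pair attached to it are determined by it and are
defined below. -/
structure EFCDatum (R K X : Type u) [CommRing R] [IsDomain R] [IsDiscreteValuationRing R]
    [Field K] [Algebra R K] [IsFractionRing R K] [AddCommGroup X] extends FCDatum R K X where
  be : Module.Dual ℤ X → X → Kˣ
  be_add_left : ∀ v w x, be (v + w) x = be v x * be w x
  be_add_right : ∀ v x x', be v (x + x') = be v x * be v x'
  be_beta : ∀ y x, be (toFCDatum.beta y) x = b y x

namespace EFCDatum

variable {R K X : Type u} [CommRing R] [IsDomain R] [IsDiscreteValuationRing R]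
  [Field K] [Algebra R K] [IsFractionRing R K] [AddCommGroup X]

/-- `ε(v) = b^e(v, φ(v))`. -/
noncomputable def eps (ξ : EFCDatum R K X) (v : Module.Dual ℤ X) : Kˣ := ξ.be v (ξ.phi v : X)

/-- `E_l(v) = l · v_s(ε(v))`. -/
noncomputable def E (ξ : EFCDatum R K X) (l : ℕ) (v : Module.Dual ℤ X) : ℤ :=
  l * vs R (ξ.eps v)

/-- `Σ_l = {α ∈ X ; E_l(v) + v(α) ≥ 0 for all v ∈ X^∨}`. -/
def Sig (ξ : EFCDatum R K X) (l : ℕ) : Set X :=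
  {α | ∀ v : Module.Dual ℤ X, 0 ≤ ξ.E l v + v α}

/-- The monomial `ξ_{l,α,v} = ε(v)^l b^e(v, α) w^{α + 2lφ(v)}` of `K[X]`. -/
noncomputable def mon (ξ : EFCDatum R K X) (l : ℕ) (α : X) (v : Module.Dual ℤ X) :
    AddMonoidAlgebra K X :=
  AddMonoidAlgebra.single (α + (2 * l) • (ξ.phi v : X)) ((ξ.eps v ^ l * ξ.be v α : Kˣ) : K)

/-- The `R`-subalgebra `A_{l,α,v}` of `K[X]` generated by the quotients
`ξ_{l,γ,v'} / ξ_{l,α,v}` with `γ ∈ Σ_l` and `v' ∈ X^∨` (note that `ξ_{l,α,v}` is a unit of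
`K[X]`). -/
noncomputable def A (ξ : EFCDatum R K X) (l : ℕ) (α : X) (v : Module.Dual ℤ X) :
    Subalgebra R (AddMonoidAlgebra K X) :=
  Algebra.adjoin R
    {f | ∃ γ ∈ ξ.Sig l, ∃ v' : Module.Dual ℤ X, f * ξ.mon l α v = ξ.mon l γ v'}

/-- The normalization `B_{l,α,v}` of `A_{l,α,v}`: its integral closure in `K[X]`, which is a normal
ring with the same fraction field as `A_{l,α,v}`. -/
noncomputable def normB (ξ : EFCDatum R K X) (l : ℕ) (α : X) (v : Module.Dual ℤ X) :
    Subalgebra R (AddMonoidAlgebra K X) :=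
  (integralClosure (ξ.A l α v) (AddMonoidAlgebra K X)).restrictScalars R

/-- `Σ_l^α = (α + 2lφ(X^∨)) ∩ Σ_l`. -/
def SigAt (ξ : EFCDatum R K X) (l : ℕ) (α : X) : Set X :=
  {β | (∃ v : Module.Dual ℤ X, β = α + (2 * l) • (ξ.phi v : X)) ∧ β ∈ ξ.Sig l}

/-- `Cone(C_l^β) = ∑_{γ ∈ Σ_l} ℝ_{≥ 0} (γ - β)`. -/
noncomputable def cone (ξ : EFCDatum R K X) (l : ℕ) (β : X) : PointedCone ℝ (XR X) :=
  PointedCone.hull ℝ {z | ∃ γ ∈ ξ.Sig l, z = toXR (γ - β)}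

/-- The `R`-algebra endomorphism `δ_v^*` of `K[X]`, `c w^x ↦ c b^e(v, x) w^x`. -/
noncomputable def delta (ξ : EFCDatum R K X) (v : Module.Dual ℤ X) :
    AddMonoidAlgebra K X →ₐ[R] AddMonoidAlgebra K X :=
  (AddMonoidAlgebra.lift K (AddMonoidAlgebra K X) X
    { toFun := fun x => AddMonoidAlgebra.single x.toAdd ((ξ.be v x.toAdd : Kˣ) : K)
      map_one' := by
        have h : ξ.be v 0 = 1 := by simpa using ξ.be_add_right v 0 0
        simp [h, AddMonoidAlgebra.one_def]
      map_mul' := fun x y => by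
        rw [AddMonoidAlgebra.single_mul_single, toAdd_mul, ξ.be_add_right, Units.val_mul] }
    ).restrictScalars R

theorem delta_single (ξ : EFCDatum R K X) (v : Module.Dual ℤ X) (x : X) (c : K) :
    ξ.delta v (AddMonoidAlgebra.single x c) =
      AddMonoidAlgebra.single x (c * ((ξ.be v x : Kˣ) : K)) := by
  simp [delta]

/-- The index set of the monomials in the special fibre: the pairs of a point
`β = α - 2lφ(v_β)` of `Σ_l^α` and a point `x` of `Cone(C_l^β) ∩ X`. -/
structure ConePoint (ξ : EFCDatum R K X) (l : ℕ) (α : X) where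
  β : X
  β_mem : β ∈ ξ.SigAt l α
  /-- the unique element `v_β` of `X^∨` with `β = α - 2lφ(v_β)` -/
  v : Module.Dual ℤ X
  β_eq : β = α - (2 * l) • (ξ.phi v : X)
  x : X
  x_mem : toXR x ∈ ξ.cone l β

/-- The points `p = (β', x)` and `q = (β'', y)` have `x` and `y` in a common cone. -/
def ConePoint.Common {ξ : EFCDatum R K X} {l : ℕ} {α : X} (p q : ξ.ConePoint l α) : Prop :=
  ∃ β ∈ ξ.SigAt l α, toXR p.x ∈ ξ.cone l β ∧ toXR q.x ∈ ξ.cone l β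

/-- `r = (β, x + y)` where `p = (β', x)`, `q = (β'', y)` and `x`, `y` lie in the cone of `β`. -/
def ConePoint.IsSum {ξ : EFCDatum R K X} {l : ℕ} {α : X} (p q r : ξ.ConePoint l α) : Prop :=
  toXR p.x ∈ ξ.cone l r.β ∧ toXR q.x ∈ ξ.cone l r.β ∧ r.x = p.x + q.x

/-- The defining relations of the special fibre in the polynomial ring `k[T_p]` over the index set:
`T_p T_q = T_r` for `r` as in `IsSum`, `T_p T_q = 0` if there is no common cone, and `T_p = 1` if
`p = (β, 0)` (that is, `s^0 w^0 = 1`). -/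
def relations (ξ : EFCDatum R K X) (l : ℕ) (α : X) :
    Set (MvPolynomial (ξ.ConePoint l α) (IsLocalRing.ResidueField R)) :=
  {f | ∃ p q r : ξ.ConePoint l α, p.IsSum q r ∧
      f = MvPolynomial.X p * MvPolynomial.X q - MvPolynomial.X r} ∪
  {f | ∃ p q : ξ.ConePoint l α, ¬ p.Common q ∧ f = MvPolynomial.X p * MvPolynomial.X q} ∪
  {f | ∃ p : ξ.ConePoint l α, p.x = 0 ∧ f = MvPolynomial.X p - 1}

end EFCDatum

/-- The monomial `s^n w^x` of `K[X]`. -/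
noncomputable def smon {R : Type u} (K : Type u) {X : Type u} [CommRing R] [Field K] [Algebra R K]
    [AddCommGroup X] (s : R) (n : ℤ) (x : X) : AddMonoidAlgebra K X :=
  AddMonoidAlgebra.single x ((algebraMap R K s) ^ n)

section Schemes

variable {R : Type u} [CommRing R]

/-- `Spec A` as a scheme over `S = Spec R`. -/
noncomputable def specOver (R A : Type u) [CommRing R] [CommRing A] [Algebra R A] :
    Over (Spec (CommRingCat.of R)) :=
  Over.mk (Spec.map (CommRingCat.ofHom (algebraMap R A)))

/-- The split torus `T_{X,R} = Spec R[X]` over `S = Spec R`. -/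
noncomputable def torus (R X : Type u) [CommRing R] [AddCommGroup X] :
    Over (Spec (CommRingCat.of R)) :=
  specOver R (AddMonoidAlgebra R X)

variable {M : Type u} [CommRing M] [Algebra R M]

/-- The morphism `Spec A₂ → Spec A₁` of `S`-schemes given by an inclusion `A₁ ⊆ A₂`. -/
noncomputable def specIncl {A₁ A₂ : Subalgebra R M} (h : A₁ ≤ A₂) :
    specOver R A₂ ⟶ specOver R A₁ :=
  Over.homMk (Spec.map (CommRingCat.ofHom (Subalgebra.inclusion h).toRingHom)) (by
    simp only [specOver, Over.mk_left, Over.mk_hom, ← Spec.map_comp, ← CommRingCat.ofHom_comp]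
    rfl)

/-- The closed fibre `(Spec A)_0 = Spec (k ⊗_R A)` of `Spec A` over the local ring `R`. -/
noncomputable abbrev closedFibre [IsLocalRing R] (A : Subalgebra R M) : Scheme.{u} :=
  Spec (CommRingCat.of (IsLocalRing.ResidueField R ⊗[R] A))

/-- The morphism `(Spec A₂)_0 → (Spec A₁)_0` of closed fibres given by an endomorphism `g` of `M`
that maps the subalgebra `A₁` into the subalgebra `A₂`. -/
noncomputable def closedFibreMap [IsLocalRing R] (g : M →ₐ[R] M) {A₁ A₂ : Subalgebra R M}
    (h : A₁ ≤ A₂.comap g) : closedFibre A₂ ⟶ closedFibre A₁ :=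
  Spec.map (CommRingCat.ofHom
    (Algebra.TensorProduct.map (AlgHom.id R (IsLocalRing.ResidueField R))
      ((g.comp A₁.val).codRestrict A₂ (fun z => h z.2))).toRingHom)

/-- The morphism `(Spec A₂)_0 → (Spec A₁)_0` of closed fibres given by an inclusion `A₁ ⊆ A₂`. -/
noncomputable def fibreIncl [IsLocalRing R] {A₁ A₂ : Subalgebra R M} (h : A₁ ≤ A₂) :
    closedFibre A₂ ⟶ closedFibre A₁ :=
  closedFibreMap (AlgHom.id R M) (fun _ hz => h hz)

end Schemes

/-- The `S`-scheme `W_{l,α,v} = Spec B_{l,α,v}`. -/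
noncomputable def EFCDatum.W {R K X : Type u} [CommRing R] [IsDomain R]
    [IsDiscreteValuationRing R] [Field K] [Algebra R K] [IsFractionRing R K] [AddCommGroup X]
    (ξ : EFCDatum R K X) (l : ℕ) (α : X) (v : Module.Dual ℤ X) :
    Over (Spec (CommRingCat.of R)) :=
  specOver R (ξ.normB l α v)

end NeronModel

/-!
The pairing `D(v, w) = v(φ(w))` on `X^∨` is symmetric and positive definite, and `v_s(b^e(v, x)) =
v(x)`. So `α ∈ Σ_l` means `w(α) ≤ l D(w, w)` for all `w`, and a point `α - 2lφ(v)` lies in `Σ_l` too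
iff equality holds for `w = v`. For `α ∈ Σ_l` let `V` be the finite set of these `v` (the `v_β`).

The key fact (`EFCDatum.normB_eq_slope`) is that `B_{l,α,u}` is the algebra of all `f ∈ K[X]` whose
coefficient at each `w^x` is divisible by `s^{n(x)}` for all slopes `n ∈ V + u`. The generators of
`A_{l,α,u}` have this property, by the inequalities that define `Σ_l`. For a single slope `n`, the
algebra `R[s^{n(x)} w^x]` is integrally closed in `K[X]`, since reduction modulo `s` gives the domain
`k[X]`; hence so is the intersection over `V + u`. Conversely, let `n = v_β + u` be a slope that is
maximal at `x`. By finiteness (`EFCDatum.finite_dualForm_le`, a Cauchy–Schwarz argument)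
`β + x / k` lies in `Σ_l(0)` for large `k`, so integrality of the polytope and Carathéodory's theorem
write a multiple of `x` as a sum of differences `γ - β`, `γ ∈ Σ_l`
(`EFCDatum.exists_nsmul_mem_closure`). A power of `s^{n(x)} w^x` is then a product of generators. The
same argument shows that `x` lies in the cone of `β` iff `v_β + u` is maximal at `x`
(`EFCDatum.toXR_mem_cone_iff_eq`).

Everything else is read off from the support function `H(x) = max_n n(x)`. The monomials
`s^{H(x)} w^x` form a basis of `B_{l,α,u}`, and in the closed fibre the product of the monomials at
`x` and `y` is the one at `x + y` if a single slope is maximal at both, and `0` otherwise. That gives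
the generators and relations. The slope `v_β + u` is strictly maximal at `-β`, so inverting that
monomial leaves only this slope: this is the open immersion of `W_{l,0,v_β+u}`. The closed fibres of
these open subschemes are spectra of domains isomorphic to `k[X]`, and the kernels of the restriction
maps intersect in `0` because each monomial survives where its slope is maximal; so their closures
are the irreducible components. At an interior point `α`, a slope form attains its maximum on the
polytope at `α` and is constant there, so `V = {0}` and `B_{l,α,u} = R[s^{u(x)} w^x]`.
-/

namespace NeronModel

/-! ### The valuation and the pairing on the dual lattice -/

section Valuation

variable {R K : Type u} [CommRing R] [IsDomain R] [IsDiscreteValuationRing R]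
  [Field K] [Algebra R K] [IsFractionRing R K]

/-- The valuation `vs` as a homomorphism to the additive group of integers. -/
noncomputable def vsHom (R : Type u) {K : Type u} [CommRing R] [IsDomain R]
    [IsDiscreteValuationRing R] [Field K] [Algebra R K] [IsFractionRing R K] :
    Additive Kˣ →+ ℤ :=
  AddMonoidHom.mk' (fun z => vs R z.toMul) (fun z w => vs_mul R z.toMul w.toMul)

theorem vs_inv (z : Kˣ) : vs R z⁻¹ = -vs R z := map_neg (vsHom R (K := K)) (Additive.ofMul z)

theorem vs_pow (z : Kˣ) (n : ℕ) : vs R (z ^ n) = n * vs R z :=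
  (map_nsmul (vsHom R (K := K)) n (Additive.ofMul z)).trans (nsmul_eq_mul _ _)

theorem vs_zpow (z : Kˣ) (n : ℤ) : vs R (z ^ n) = n * vs R z :=
  (map_zsmul (vsHom R (K := K)) n (Additive.ofMul z)).trans (smul_eq_mul _ _)

theorem vs_uniformizer {s : R} (hs : Irreducible s) (t : Kˣ) (ht : (t : K) = algebraMap R K s) :
    vs R t = 1 := by
  rw [vs, ht]
  have h := (IsDiscreteValuationRing.maximalIdeal R).valuation_of_algebraMap (K := K) s
  rw [h, IsDedekindDomain.HeightOneSpectrum.intValuation_singleton _ hs.ne_zero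
    (by exact (Irreducible.maximalIdeal_eq hs))]
  simp

/-- A unit of `K` has valuation at least `n` iff it is divisible by `s ^ n` in `R`. -/
theorem le_vs_iff {s : R} (hs : Irreducible s) (c : Kˣ) (n : ℤ) :
    n ≤ vs R c ↔ ∃ r : R, (c : K) = algebraMap R K r * (algebraMap R K s) ^ n := by
  have hs0 : algebraMap R K s ≠ 0 := by simpa using hs.ne_zero
  set t : Kˣ := Units.mk0 _ hs0 with ht
  have hvt : vs R t = 1 := vs_uniformizer hs t rfl
  have key : ∀ d : Kˣ, 0 ≤ vs R d ↔ ∃ r : R, (d : K) = algebraMap R K r := by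
    intro d
    have hd : (IsDiscreteValuationRing.maximalIdeal R).valuation K (d : K) ≠ 0 := by simp
    have h1 : 0 ≤ vs R d ↔ (IsDiscreteValuationRing.maximalIdeal R).valuation K (d : K) ≤ 1 := by
      rw [vs, ← WithZero.log_le_log hd one_ne_zero, WithZero.log_one]
      omega
    rw [h1]
    constructor
    · intro h
      obtain ⟨r, hr⟩ := IsDiscreteValuationRing.exists_lift_of_le_one h
      exact ⟨r, hr.symm⟩
    · rintro ⟨r, hr⟩
      rw [hr]
      exact IsDedekindDomain.HeightOneSpectrum.valuation_le_one _ r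
  have h2 : n ≤ vs R c ↔ 0 ≤ vs R (c * (t ^ n)⁻¹) := by
    rw [vs_mul, vs_inv, vs_zpow, hvt]
    omega
  rw [h2, key]
  refine exists_congr fun r => ?_
  have hne : algebraMap R K s ^ n ≠ 0 := zpow_ne_zero _ hs0
  simp only [Units.val_mul, Units.val_inv_eq_inv_val, Units.val_zpow_eq_zpow_val, ht,
    Units.val_mk0]
  rw [← div_eq_mul_inv, div_eq_iff hne]

end Valuation

namespace EFCDatum

variable {R K X : Type u} [CommRing R] [IsDomain R] [IsDiscreteValuationRing R]
  [Field K] [Algebra R K] [IsFractionRing R K] [AddCommGroup X]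

/-- `N` is not the junk value `0` of an infinite quotient: `X`, `Y` and `X^∨` have the same rank. -/
theorem N_ne_zero [Module.Free ℤ X] [Module.Finite ℤ X] (ξ : EFCDatum R K X) :
    ξ.N ≠ 0 := by
  have hinj : Function.Injective (ξ.beta.rangeRestrict ∘ₗ ξ.indexMul.toIntLinearMap) := by
    refine ((ξ.beta_injective.codRestrict
      (fun x => LinearMap.mem_range_self ξ.beta x)).comp ?_ :
      Function.Injective (ξ.beta.rangeRestrict ∘ ξ.indexMul))
    intro x y hxy
    have h : ξ.Y.index • x = ξ.Y.index • y := congrArg Subtype.val hxy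
    have : IsAddTorsionFree X := .of_isTorsionFree ℤ X
    exact (smul_right_inj ξ.finiteIndex.index_ne_zero).mp h
  have h1 := LinearMap.finrank_le_finrank_of_injective hinj
  have h2 : Module.finrank ℤ (LinearMap.range ξ.beta) ≤ Module.finrank ℤ (Module.Dual ℤ X) :=
    Submodule.finrank_le _
  have h3 : Module.finrank ℤ (Module.Dual ℤ X) = Module.finrank ℤ X :=
    (Module.finrank_linearMap ℤ ℤ X ℤ).trans (by simp)
  have := Submodule.finiteQuotientOfFreeOfRankEq (LinearMap.range ξ.beta) (by omega)
  exact Nat.card_pos.ne'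

/-- The pairing `(v, w) ↦ v(φ(w))` on `X^∨`. It is `N⁻¹` times the pull-back of `B` along `φ`,
hence symmetric and positive definite. -/
noncomputable def dualForm (ξ : EFCDatum R K X) (v w : Module.Dual ℤ X) : ℤ := v (ξ.phi w : X)

theorem N_mul_apply (ξ : EFCDatum R K X) (v : Module.Dual ℤ X) (x : X) :
    (ξ.N : ℤ) * v x = ξ.B (ξ.phi v) x := by
  rw [← FCDatum.beta_apply, ξ.beta_phi]
  simp

theorem dualForm_add_left (ξ : EFCDatum R K X) (v v' w : Module.Dual ℤ X) :
    ξ.dualForm (v + v') w = ξ.dualForm v w + ξ.dualForm v' w := rfl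

theorem dualForm_add_right (ξ : EFCDatum R K X) (v w w' : Module.Dual ℤ X) :
    ξ.dualForm v (w + w') = ξ.dualForm v w + ξ.dualForm v w' := by
  simp [dualForm]

theorem dualForm_neg_left (ξ : EFCDatum R K X) (v w : Module.Dual ℤ X) :
    ξ.dualForm (-v) w = -ξ.dualForm v w := rfl

theorem dualForm_neg_right (ξ : EFCDatum R K X) (v w : Module.Dual ℤ X) :
    ξ.dualForm v (-w) = -ξ.dualForm v w := by
  simp [dualForm]

variable [Module.Free ℤ X] [Module.Finite ℤ X]

theorem dualForm_comm (ξ : EFCDatum R K X) (v w : Module.Dual ℤ X) :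
    ξ.dualForm v w = ξ.dualForm w v := by
  have hN : (ξ.N : ℤ) ≠ 0 := by exact_mod_cast ξ.N_ne_zero
  apply mul_left_cancel₀ hN
  rw [dualForm, dualForm, N_mul_apply, N_mul_apply]
  exact ξ.B_symm _ _

theorem phi_injective (ξ : EFCDatum R K X) : Function.Injective ξ.phi := by
  intro v w h
  have hN : (ξ.N : ℤ) ≠ 0 := by exact_mod_cast ξ.N_ne_zero
  ext x
  apply mul_left_cancel₀ hN
  rw [N_mul_apply, N_mul_apply, h]

theorem dualForm_self_pos (ξ : EFCDatum R K X) {v : Module.Dual ℤ X} (hv : v ≠ 0) :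
    0 < ξ.dualForm v v := by
  have hN : (0 : ℤ) < ξ.N := by exact_mod_cast Nat.pos_of_ne_zero ξ.N_ne_zero
  have h : 0 < ξ.B (ξ.phi v) (ξ.phi v : X) :=
    ξ.B_pos _ fun h => hv (ξ.phi_injective (h.trans (map_zero _).symm))
  rw [← N_mul_apply] at h
  exact pos_of_mul_pos_right h hN.le

theorem dualForm_self_nonneg (ξ : EFCDatum R K X) (v : Module.Dual ℤ X) :
    0 ≤ ξ.dualForm v v := by
  by_cases hv : v = 0
  · simp [hv, dualForm]
  · exact (ξ.dualForm_self_pos hv).le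

theorem vs_be (ξ : EFCDatum R K X) (v : Module.Dual ℤ X) (x : X) : vs R (ξ.be v x) = v x := by
  have hN : (ξ.N : ℤ) ≠ 0 := by exact_mod_cast ξ.N_ne_zero
  apply mul_left_cancel₀ hN
  let g : Module.Dual ℤ X →+ ℤ := AddMonoidHom.mk' (fun v => vs R (ξ.be v x))
    (fun v w => by rw [ξ.be_add_left, vs_mul])
  have h := map_nsmul g ξ.N v
  have h2 : g (ξ.N • v) = ξ.B (ξ.phi v) x := by
    rw [← ξ.beta_phi]
    change vs R (ξ.be _ x) = _
    rw [ξ.be_beta]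
    rfl
  rw [h2, ← N_mul_apply, nsmul_eq_mul] at h
  exact h.symm

theorem E_eq (ξ : EFCDatum R K X) (l : ℕ) (v : Module.Dual ℤ X) :
    ξ.E l v = l * ξ.dualForm v v := by
  rw [E, eps, vs_be, dualForm]

theorem mem_Sig_iff (ξ : EFCDatum R K X) (l : ℕ) (α : X) :
    α ∈ ξ.Sig l ↔ ∀ w : Module.Dual ℤ X, w α ≤ l * ξ.dualForm w w := by
  constructor
  · intro h w
    have := h (-w)
    rw [E_eq, dualForm_neg_left, dualForm_neg_right, LinearMap.neg_apply] at this
    linarith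
  · intro h w
    have := h (-w)
    rw [dualForm_neg_left, dualForm_neg_right, LinearMap.neg_apply] at this
    rw [E_eq]
    linarith

/-- The Cauchy–Schwarz inequality for `B`, in the form that bounds `v(y)` by the length of `v`. -/
theorem sq_apply_le (ξ : EFCDatum R K X) (v : Module.Dual ℤ X) (y : ξ.Y) :
    (v (y : X)) ^ 2 ≤ ξ.B y (y : X) * ξ.dualForm v v := by
  have hN : (1 : ℤ) ≤ ξ.N := by exact_mod_cast Nat.pos_of_ne_zero ξ.N_ne_zero
  by_cases hy : y = 0
  · subst hy
    have h0 : ξ.B 0 ((0 : ξ.Y) : X) = 0 := by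
      rw [← FCDatum.beta_apply, map_zero, LinearMap.zero_apply]
    rw [h0]
    simp
  set z := ξ.phi v with hz
  set a := ξ.B y (y : X) with ha
  have hapos : 0 < a := ξ.B_pos y hy
  set c := ξ.B z (y : X) with hc
  set e := ξ.B z (z : X) with he
  have hyz : ξ.B y (z : X) = c := ξ.B_symm _ _
  have hnn : ∀ t : ξ.Y, 0 ≤ ξ.beta t (t : X) := by
    intro t
    by_cases ht : t = 0
    · simp [ht]
    · exact (ξ.B_pos t ht).le
  -- `a z - c y` is `a` times the component of `z` orthogonal to `y`
  have h := hnn (a • z - c • y)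
  have hexp : ξ.beta (a • z - c • y) ((a • z - c • y : ξ.Y) : X) = a * (a * e - c ^ 2) := by
    simp only [map_sub, map_smul, LinearMap.sub_apply, LinearMap.smul_apply, AddSubgroup.coe_sub,
      AddSubgroup.coe_zsmul, FCDatum.beta_apply, smul_eq_mul, hyz, ← ha, ← hc, ← he]
    ring
  rw [hexp] at h
  have h1 : c ^ 2 ≤ a * e := by
    have := nonneg_of_mul_nonneg_right h hapos
    linarith
  have hcv : c = ξ.N * v (y : X) := (ξ.N_mul_apply v y).symm
  have hev : e = ξ.N * ξ.dualForm v v := (ξ.N_mul_apply v _).symm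
  rw [hcv, hev] at h1
  have h2 : (ξ.N : ℤ) * (v (y : X)) ^ 2 ≤ a * ξ.dualForm v v := by
    have : (ξ.N : ℤ) * (ξ.N * (v (y : X)) ^ 2) ≤ ξ.N * (a * ξ.dualForm v v) := by
      linarith
    exact le_of_mul_le_mul_left this (by omega)
  nlinarith [sq_nonneg (v (y : X))]

theorem exists_sq_apply_le (ξ : EFCDatum R K X) (x : X) :
    ∃ C : ℤ, 0 ≤ C ∧ ∀ v : Module.Dual ℤ X, (v x) ^ 2 ≤ C * ξ.dualForm v v := by
  refine ⟨ξ.B (ξ.indexMul x) (ξ.indexMul x : X), ?_, fun v => ?_⟩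
  · by_cases h : ξ.indexMul x = 0
    · rw [h, ← FCDatum.beta_apply, map_zero, LinearMap.zero_apply]
    · exact (ξ.B_pos _ h).le
  · have h := ξ.sq_apply_le v (ξ.indexMul x)
    have h1 : v (ξ.indexMul x : X) = ξ.Y.index * v x := by
      change v (ξ.Y.index • x) = _
      rw [map_nsmul, nsmul_eq_mul]
    have h2 : (1 : ℤ) ≤ ξ.Y.index := by
      exact_mod_cast Nat.pos_of_ne_zero ξ.finiteIndex.index_ne_zero
    rw [h1] at h
    nlinarith [sq_nonneg (v x), sq_nonneg ((ξ.Y.index : ℤ) - 1)]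

/-- A quadratic form that is positive definite on a lattice dominates linear forms outside a finite
set. -/
theorem finite_dualForm_le (ξ : EFCDatum R K X) {l : ℕ} (hl : 0 < l) (p : X) :
    {v : Module.Dual ℤ X | l * ξ.dualForm v v ≤ v p}.Finite := by
  obtain ⟨C, hC0, hC⟩ := ξ.exists_sq_apply_le p
  have hb : ∀ v ∈ {v : Module.Dual ℤ X | l * ξ.dualForm v v ≤ v p}, ξ.dualForm v v ≤ C := by
    intro v hv
    have hl' : (1 : ℤ) ≤ l := by exact_mod_cast hl
    have h0 := ξ.dualForm_self_nonneg v
    have h1 : ξ.dualForm v v ≤ v p := le_trans (by nlinarith) hv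
    have h2 := hC v
    rcases h0.eq_or_lt with h | h
    · rw [← h]; exact hC0
    · nlinarith
  let e := Module.Free.chooseBasis ℤ X
  choose M hM0 hM using fun i => ξ.exists_sq_apply_le (e i)
  have hinj : Function.Injective (fun (v : Module.Dual ℤ X) i => v (e i)) := by
    intro v w h
    exact e.ext fun i => congrFun h i
  refine Set.Finite.of_finite_image (f := fun (v : Module.Dual ℤ X) i => v (e i)) ?_ hinj.injOn
  refine (Set.finite_Icc (fun i => -(M i * C)) (fun i => M i * C)).subset ?_
  rintro _ ⟨v, hv, rfl⟩
  have h1 : ∀ i, (v (e i)) ^ 2 ≤ M i * C := fun i =>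
    (hM i v).trans (mul_le_mul_of_nonneg_left (hb v hv) (hM0 i))
  have h2 : ∀ i, |v (e i)| ≤ M i * C := fun i => by
    refine le_trans ?_ (h1 i)
    rw [← sq_abs]
    nlinarith [abs_nonneg (v (e i))]
  exact ⟨fun i => (abs_le.mp (h2 i)).1, fun i => (abs_le.mp (h2 i)).2⟩

end EFCDatum

/-! ### Voronoi polytopes and their local cones -/

section XR

variable {X : Type u} [AddCommGroup X]

/-- The real linear extension of an integral linear form on `X` to `X_ℝ`. -/
noncomputable def realExt (w : Module.Dual ℤ X) : XR X →ₗ[ℝ] ℝ :=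
  Module.Dual.baseChange ℝ w

@[simp] theorem realExt_tmul (w : Module.Dual ℤ X) (r : ℝ) (x : X) :
    realExt w (r ⊗ₜ x) = w x * r := by
  simp [realExt]

@[simp] theorem realExt_toXR (w : Module.Dual ℤ X) (x : X) : realExt w (toXR x) = w x := by
  simp [toXR]

/-- The canonical map `X → X_ℝ` as an additive homomorphism. -/
noncomputable def toXRHom : X →+ XR X :=
  AddMonoidHom.mk' toXR fun _ _ => TensorProduct.tmul_add _ _ _

theorem toXR_zero : toXR (0 : X) = 0 := map_zero toXRHom

theorem toXR_sub (x y : X) : toXR (x - y) = toXR x - toXR y := map_sub toXRHom x y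

theorem toXR_add (x y : X) : toXR (x + y) = toXR x + toXR y := map_add toXRHom x y

theorem toXR_nsmul (n : ℕ) (x : X) : toXR (n • x) = (n : ℝ) • toXR x :=
  (map_nsmul toXRHom n x).trans (Nat.cast_smul_eq_nsmul ℝ n _).symm

theorem toXR_injective [Module.Free ℤ X] : Function.Injective (toXR : X → XR X) := by
  have h := Module.Flat.rTensor_preserves_injective_linearMap (M := X)
    (Algebra.linearMap ℤ ℝ) (algebraMap ℤ ℝ).injective_int
  intro x y hxy
  have h1 : (1 : ℤ) ⊗ₜ[ℤ] x = 1 ⊗ₜ[ℤ] y := h (by simpa [toXR] using hxy)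
  simpa using congrArg (TensorProduct.lid ℤ X) h1

/-- A rational point of the convex hull of a set of lattice points is a rational convex combination
of these points. The coefficients of an affinely independent combination are fixed by every
`ℚ`-linear projection `ℝ → ℚ`, because they are determined by the point. -/
theorem exists_nsmul_mem_closure_of_mem_convexHull [Module.Free ℤ X] {T : Set X} {β x : X} {k : ℕ}
    (hk : 0 < k) (h : toXR β + (k : ℝ)⁻¹ • toXR x ∈ convexHull ℝ (toXR '' T)) :
    ∃ d : ℕ, 0 < d ∧ d • x ∈ AddSubmonoid.closure ((fun γ => γ - β) '' T) := by
  obtain ⟨ι, _, z, w, hz, hind, hpos, hsum, hx⟩ := eq_pos_convex_span_of_mem_convexHull h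
  have hk0 : (k : ℝ) ≠ 0 := by exact_mod_cast hk.ne'
  choose γ hγT hγ using fun i => hz (Set.mem_range_self i)
  -- apply a `ℚ`-linear retraction `ρ : ℝ → ℚ` to the coefficients
  obtain ⟨ρ, hρ⟩ := (Algebra.linearMap ℚ ℝ).exists_leftInverse_of_injective
    (LinearMap.ker_eq_bot.mpr (algebraMap ℚ ℝ).injective)
  have hρ' : ∀ q : ℚ, ρ (q : ℝ) = q := fun q => LinearMap.congr_fun hρ q
  let σ : ℝ →ₗ[ℤ] ℝ := ((Algebra.linearMap ℚ ℝ) ∘ₗ ρ).restrictScalars ℤ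
  have hσ : ∀ r, σ r = (ρ r : ℝ) := fun r => rfl
  have hx' : ∑ i, w i • toXR (γ i) = toXR β + (k : ℝ)⁻¹ • toXR x := by
    rw [← hx]
    exact Finset.sum_congr rfl fun i _ => by rw [hγ]
  have hsm : ∀ (r : ℝ) (y : X), r • toXR y = r ⊗ₜ[ℤ] y := fun r y => by
    simp [toXR, TensorProduct.smul_tmul']
  have hσx : ∑ i, σ (w i) • toXR (γ i) = toXR β + (k : ℝ)⁻¹ • toXR x := by
    have h1 := congrArg (σ.rTensor X) hx'
    have hβ : toXR β = (1 : ℝ) • toXR β := (one_smul _ _).symm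
    rw [map_sum, map_add, hβ] at h1
    simp only [hsm, LinearMap.rTensor_tmul] at h1
    have e1 : σ 1 = 1 := by
      have := hρ' 1
      rw [hσ]; push_cast at this; rw [this]; simp
    have e2 : σ (k : ℝ)⁻¹ = (k : ℝ)⁻¹ := by
      have := hρ' (k : ℚ)⁻¹
      rw [hσ]; push_cast at this; rw [this]; simp
    rw [e1, e2] at h1
    rw [hβ]
    simp only [hsm]
    exact h1
  have hσs : ∑ i, σ (w i) = 1 := by
    rw [← map_sum, hsum, hσ]
    have := hρ' 1
    push_cast at this; rw [this]; simp
  have hfix : ∀ i, σ (w i) = w i := by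
    have h2 := hind.eq_zero_of_sum_eq_zero (s := Finset.univ) (w := fun i => σ (w i) - w i)
      (by rw [Finset.sum_sub_distrib, hσs, hsum, sub_self])
      (by
        simp only [sub_smul, Finset.sum_sub_distrib, ← hγ]
        rw [hσx, hx', sub_self])
    intro i
    exact sub_eq_zero.mp (h2 i (Finset.mem_univ i))
  -- clear the denominators of the rational numbers `ρ (w i)`
  let d : ℕ := ∏ i, (ρ (w i)).den
  have hd : 0 < d := Finset.prod_pos fun i _ => (ρ (w i)).den_pos
  have hn : ∀ i, ∃ n : ℕ, (n : ℝ) = d * w i := by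
    intro i
    obtain ⟨e, he⟩ : (ρ (w i)).den ∣ d := Finset.dvd_prod_of_mem _ (Finset.mem_univ i)
    have h0 : (0 : ℚ) < ρ (w i) := by
      have := hpos i
      rw [← hfix i, hσ] at this
      exact_mod_cast this
    have h1 : 0 < (ρ (w i)).num := Rat.num_pos.mpr h0
    refine ⟨e * (ρ (w i)).num.toNat, ?_⟩
    have h2 : (((ρ (w i)).num.toNat : ℤ)) = (ρ (w i)).num := Int.toNat_of_nonneg h1.le
    have h3 : (((ρ (w i)).num.toNat : ℕ) : ℚ) = (ρ (w i)).num := by exact_mod_cast h2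
    have h4 : ((e * (ρ (w i)).num.toNat : ℕ) : ℚ) = d * ρ (w i) := by
      rw [he]
      push_cast
      rw [h3]
      have := Rat.den_mul_eq_num (ρ (w i))
      rw [mul_right_comm, this, mul_comm]
    have h5 : ((((e * (ρ (w i)).num.toNat : ℕ) : ℚ) : ℝ)) = ((d * ρ (w i) : ℚ) : ℝ) := by rw [h4]
    rw [Rat.cast_natCast, Rat.cast_mul, Rat.cast_natCast, ← hσ, hfix] at h5
    exact h5
  choose n hn using hn
  refine ⟨d, hd, ?_⟩
  have hmain : d • x = ∑ i, (k * n i) • (γ i - β) := by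
    apply toXR_injective
    change toXRHom _ = toXRHom _
    simp only [map_sum, map_nsmul]
    change d • toXR x = ∑ i, (k * n i) • toXR (γ i - β)
    simp only [← Nat.cast_smul_eq_nsmul ℝ, toXR_sub, smul_sub, Finset.sum_sub_distrib,
      ← Finset.sum_smul]
    push_cast
    simp only [mul_smul, ← Finset.smul_sum, ← Finset.mul_sum, hn]
    rw [hx', hsum]
    simp only [smul_add, smul_smul, mul_one]
    rw [mul_left_comm, mul_inv_cancel₀ hk0, mul_one]
    abel
  rw [hmain]
  exact AddSubmonoid.sum_mem _ fun i _ => AddSubmonoid.nsmul_mem _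
    (AddSubmonoid.subset_closure (Set.mem_image_of_mem _ (hγT i))) _

end XR

namespace EFCDatum

variable {R K X : Type u} [CommRing R] [IsDomain R] [IsDiscreteValuationRing R]
  [Field K] [Algebra R K] [IsFractionRing R K] [AddCommGroup X]

/-- The vectors `v ∈ X^∨` with `α - 2lφ(v) ∈ Σ_l`, that is, the elements `v_β` for `β ∈ Σ_l^α`.
They index the Voronoi polytopes that contain `α`. -/
def cells (ξ : EFCDatum R K X) (l : ℕ) (α : X) : Set (Module.Dual ℤ X) :=
  {v | α - (2 * l) • (ξ.phi v : X) ∈ ξ.Sig l}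

theorem zero_mem_cells {ξ : EFCDatum R K X} {l : ℕ} {α : X} (hα : α ∈ ξ.Sig l) :
    0 ∈ ξ.cells l α := by
  simpa [cells] using hα

theorem add_mem_cells_iff (ξ : EFCDatum R K X) (l : ℕ) (α : X) (v w : Module.Dual ℤ X) :
    w ∈ ξ.cells l (α - (2 * l) • (ξ.phi v : X)) ↔ v + w ∈ ξ.cells l α := by
  simp [cells, sub_sub]

variable [Module.Free ℤ X] [Module.Finite ℤ X]

theorem mem_cells_iff {ξ : EFCDatum R K X} {l : ℕ} {α : X} (hα : α ∈ ξ.Sig l)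
    (v : Module.Dual ℤ X) : v ∈ ξ.cells l α ↔ v α = l * ξ.dualForm v v := by
  have hsub : ∀ w : Module.Dual ℤ X,
      w (α - (2 * l) • (ξ.phi v : X)) = w α - 2 * l * ξ.dualForm w v := by
    intro w
    simp [dualForm]
  rw [cells, Set.mem_ofPred_eq, mem_Sig_iff]
  rw [mem_Sig_iff] at hα
  constructor
  · intro h
    have h1 := h (-v)
    rw [hsub, dualForm_neg_left, dualForm_neg_left, dualForm_neg_right,
      LinearMap.neg_apply] at h1
    exact le_antisymm (hα v) (by linarith)
  · intro h w
    have h1 := hα (w + v)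
    rw [hsub]
    simp only [dualForm_add_left, dualForm_add_right, LinearMap.add_apply] at h1
    rw [ξ.dualForm_comm v w] at h1
    linarith

theorem cells_finite {ξ : EFCDatum R K X} {l : ℕ} (hl : 0 < l) {α : X} (hα : α ∈ ξ.Sig l) :
    (ξ.cells l α).Finite :=
  (ξ.finite_dualForm_le hl α).subset fun _ hv => ((mem_cells_iff hα _).mp hv).ge

omit [Module.Free ℤ X] [Module.Finite ℤ X] in
theorem BR_symm (ξ : EFCDatum R K X) (z z' : XR X) : ξ.BR z z' = ξ.BR z' z := by
  have h0 : (ξ.Y.index : ℤ) ≠ 0 := by exact_mod_cast ξ.finiteIndex.index_ne_zero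
  have h : ∀ x x' : X, ξ.BInt x x' = ξ.BInt x' x := by
    intro x x'
    apply mul_left_cancel₀ h0
    have h1 : ∀ x x' : X, (ξ.Y.index : ℤ) * ξ.BInt x x' =
        ξ.B (ξ.indexMul x) (ξ.indexMul x' : X) := by
      intro x x'
      change _ * ξ.beta (ξ.indexMul x) x' = ξ.beta (ξ.indexMul x) (ξ.Y.index • x')
      rw [map_nsmul, nsmul_eq_mul]
    rw [h1, h1]
    exact ξ.B_symm _ _
  have hs : LinearMap.IsSymm ξ.BInt := ⟨h⟩
  have := (LinearMap.BilinForm.IsSymm.baseChange ℝ hs).eq z z'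
  rw [RingHom.id_apply] at this
  simp only [FCDatum.BR, LinearMap.smul_apply]
  rw [this]

omit [Module.Free ℤ X] [Module.Finite ℤ X] in
theorem BR_phi (ξ : EFCDatum R K X) (v : Module.Dual ℤ X) (z : XR X) :
    ξ.BR (toXR (ξ.phi v : X)) z = ξ.N * realExt v z := by
  have h : ξ.BR (toXR (ξ.phi v : X)) = (ξ.N : ℝ) • realExt v := by
    ext x
    have h1 := ξ.BR_toXR (ξ.phi v) x
    rw [← N_mul_apply] at h1
    simp only [toXR] at h1
    simpa [toXR] using h1
  rw [h]
  rfl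

omit [Module.Free ℤ X] [Module.Finite ℤ X] in
theorem BR_sub_phi (ξ : EFCDatum R K X) (l : ℕ) (v : Module.Dual ℤ X) (z : XR X) :
    ξ.BR (z - toXR ((2 * l) • (ξ.phi v : X))) (z - toXR ((2 * l) • (ξ.phi v : X))) =
      ξ.BR z z + 4 * l * ξ.N * (l * ξ.dualForm v v - realExt v z) := by
  rw [toXR_nsmul]
  simp only [map_sub, map_smul, LinearMap.sub_apply, LinearMap.smul_apply, BR_phi, smul_eq_mul,
    ξ.BR_symm z (toXR (ξ.phi v : X)), realExt_toXR]
  rw [dualForm]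
  push_cast
  ring

omit [Module.Free ℤ X] [Module.Finite ℤ X] in
theorem mem_voronoi_of_forall_le {ξ : EFCDatum R K X} {l : ℕ} {z : XR X}
    (h : ∀ w : Module.Dual ℤ X, realExt w z ≤ l * ξ.dualForm w w) : z ∈ ξ.voronoi l 0 := by
  intro v
  refine Real.sqrt_le_sqrt ?_
  rw [map_zero, AddSubgroup.coe_zero, smul_zero, toXR_zero, sub_zero, BR_sub_phi]
  have := h v
  have h2 : 0 ≤ 4 * (l : ℝ) * ξ.N * (l * ξ.dualForm v v - realExt v z) :=
    mul_nonneg (by positivity) (by linarith)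
  linarith

omit [Module.Free ℤ X] [Module.Finite ℤ X] in
theorem BR_toXR_self_nonneg (ξ : EFCDatum R K X) (x : X) : 0 ≤ ξ.BR (toXR x) (toXR x) := by
  have h0 : (0 : ℝ) < ξ.Y.index := by
    exact_mod_cast Nat.pos_of_ne_zero ξ.finiteIndex.index_ne_zero
  have h1 := ξ.BR_toXR (ξ.indexMul x) (ξ.indexMul x : X)
  have h2 : (ξ.indexMul x : X) = ξ.Y.index • x := rfl
  have h3 : (0 : ℝ) ≤ ξ.B (ξ.indexMul x) (ξ.indexMul x : X) := by
    by_cases h : ξ.indexMul x = 0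
    · rw [h, ← FCDatum.beta_apply, map_zero, LinearMap.zero_apply]; simp
    · exact_mod_cast (ξ.B_pos _ h).le
  rw [← h1, h2, toXR_nsmul] at h3
  simp only [map_smul, LinearMap.smul_apply, smul_eq_mul] at h3
  exact nonneg_of_mul_nonneg_right (nonneg_of_mul_nonneg_right h3 h0) h0

theorem toXR_mem_voronoi_iff {ξ : EFCDatum R K X} {l : ℕ} (hl : 0 < l) {x : X} :
    toXR x ∈ ξ.voronoi l 0 ↔ x ∈ ξ.Sig l := by
  rw [mem_Sig_iff]
  constructor
  · intro h w
    have h1 := h w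
    rw [map_zero, AddSubgroup.coe_zero, smul_zero, toXR_zero, sub_zero, FCDatum.len, FCDatum.len,
      Real.sqrt_le_sqrt_iff (by rw [← toXR_sub]; exact ξ.BR_toXR_self_nonneg _), BR_sub_phi,
      realExt_toXR] at h1
    have hN : (0 : ℝ) < ξ.N := by exact_mod_cast Nat.pos_of_ne_zero ξ.N_ne_zero
    have hl' : (0 : ℝ) < l := by exact_mod_cast hl
    have h2 : (0 : ℝ) ≤ l * ξ.dualForm w w - w x :=
      nonneg_of_mul_nonneg_right (a := 4 * (l : ℝ) * ξ.N) (by linarith) (by positivity)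
    have h3 : ((w x : ℤ) : ℝ) ≤ ((l * ξ.dualForm w w : ℤ) : ℝ) := by push_cast; linarith
    exact_mod_cast h3
  · intro h
    refine mem_voronoi_of_forall_le fun w => ?_
    rw [realExt_toXR]
    exact_mod_cast h w

theorem voronoi_eq_convexHull {ξ : EFCDatum R K X} {l : ℕ} (hl : 0 < l)
    (hint : IsIntegralPolytope (ξ.voronoi l 0)) :
    ξ.voronoi l 0 = convexHull ℝ (toXR '' ξ.Sig l) := by
  have h : ξ.voronoi l 0 ∩ Set.range toXR = toXR '' ξ.Sig l := by
    ext z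
    constructor
    · rintro ⟨hz, x, rfl⟩
      exact ⟨x, (toXR_mem_voronoi_iff hl).mp hz, rfl⟩
    · rintro ⟨x, hx, rfl⟩
      exact ⟨(toXR_mem_voronoi_iff hl).mpr hx, x, rfl⟩
  rw [← h]
  exact hint.1

theorem realExt_le_of_mem_voronoi {ξ : EFCDatum R K X} {l : ℕ} (hl : 0 < l)
    (hint : IsIntegralPolytope (ξ.voronoi l 0)) {z : XR X} (hz : z ∈ ξ.voronoi l 0)
    (w : Module.Dual ℤ X) : realExt w z ≤ l * ξ.dualForm w w := by
  rw [voronoi_eq_convexHull hl hint] at hz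
  refine convexHull_min ?_ (convex_halfSpace_le (realExt w).isLinear
    ((l : ℝ) * ξ.dualForm w w)) hz
  rintro _ ⟨γ, hγ, rfl⟩
  rw [Set.mem_ofPred_eq, realExt_toXR]
  exact_mod_cast (ξ.mem_Sig_iff l γ).mp hγ w

/-- An interior lattice point of the Voronoi polytope of `0` lies in no other Voronoi polytope. -/
theorem cells_eq_of_mem_intrinsicInterior {ξ : EFCDatum R K X} {l : ℕ} (hl : 0 < l)
    (hint : IsIntegralPolytope (ξ.voronoi l 0)) {α : X} (hα : α ∈ ξ.Sig l)
    (h : toXR α ∈ intrinsicInterior ℝ (ξ.voronoi l 0)) : ξ.cells l α = {0} := by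
  have : IsModuleTopology ℝ (XR X) := ⟨rfl⟩
  have : ContinuousAdd (XR X) := IsModuleTopology.toContinuousAdd ℝ (XR X)
  have : ContinuousSMul ℝ (XR X) := IsModuleTopology.toContinuousSMul ℝ (XR X)
  refine Set.eq_singleton_iff_unique_mem.mpr ⟨zero_mem_cells hα, fun w hw => ?_⟩
  by_contra hw0
  rw [mem_cells_iff hα] at hw
  obtain ⟨y, hy, hyα⟩ := mem_intrinsicInterior.mp h
  -- the ray from `0` through `α` stays in the polytope a little beyond `α`
  have hmem : ∀ t : ℝ, toXR α + t • toXR α ∈ affineSpan ℝ (ξ.voronoi l 0) := by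
    intro t
    have h1 := AffineMap.lineMap_mem (1 + t)
      (subset_affineSpan ℝ _ hint.2.2.1) (hyα ▸ y.2 : toXR α ∈ affineSpan ℝ (ξ.voronoi l 0))
    rw [AffineMap.lineMap_apply_module] at h1
    simpa [add_smul] using h1
  let g : ℝ → affineSpan ℝ (ξ.voronoi l 0) := fun t => ⟨toXR α + t • toXR α, hmem t⟩
  have hg : Continuous g := by
    have h : Continuous fun t : ℝ => toXR α + t • toXR α := by fun_prop
    exact h.subtype_mk hmem
  have hg0 : g 0 = y := Subtype.ext (by simp [g, hyα])
  have hnhds : ((↑) : affineSpan ℝ (ξ.voronoi l 0) → XR X) ⁻¹' ξ.voronoi l 0 ∈ nhds (g 0) := by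
    rw [hg0]
    exact mem_interior_iff_mem_nhds.mp hy
  have hev := hg.continuousAt.preimage_mem_nhds hnhds
  obtain ⟨ε, hε, hball⟩ := Metric.mem_nhds_iff.mp hev
  have hin : toXR α + (ε / 2) • toXR α ∈ ξ.voronoi l 0 := by
    have : ε / 2 ∈ Metric.ball (0 : ℝ) ε := by
      rw [Metric.mem_ball, Real.dist_eq, sub_zero, abs_of_pos (by linarith)]
      linarith
    exact hball this
  have h2 := realExt_le_of_mem_voronoi hl hint hin w
  have h3 : ((w α : ℤ) : ℝ) = l * ξ.dualForm w w := by rw [hw]; push_cast; ring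
  rw [map_add, map_smul, realExt_toXR, smul_eq_mul, h3] at h2
  have h4 : (0 : ℝ) < l * ξ.dualForm w w := by
    have := ξ.dualForm_self_pos hw0
    have hl' : (0 : ℝ) < l := by exact_mod_cast hl
    exact mul_pos hl' (by exact_mod_cast this)
  nlinarith

/-- A lattice vector on which no other cell containing `β` is larger points into the polytope
`Σ_l(0)` at `β`, so a multiple of it is a sum of differences `γ - β` with `γ ∈ Σ_l`. -/
theorem exists_nsmul_mem_closure {ξ : EFCDatum R K X} {l : ℕ} (hl : 0 < l)
    (hint : IsIntegralPolytope (ξ.voronoi l 0)) {β x : X} (hβ : β ∈ ξ.Sig l)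
    (hx : ∀ w ∈ ξ.cells l β, w x ≤ 0) :
    ∃ d : ℕ, 0 < d ∧ d • x ∈ AddSubmonoid.closure ((fun γ => γ - β) '' ξ.Sig l) := by
  have hfin := ξ.finite_dualForm_le hl (β + x)
  obtain ⟨M, hM⟩ := (hfin.image fun w => w x).bddAbove
  -- for `w` outside the cells of `β` the integer `l D(w, w) - w(β)` is at least `1`, so `k` has to
  -- exceed `w(x)` only for the finitely many `w` with `l D(w, w) ≤ w(β + x)`
  set k : ℕ := M.toNat + 1 with hk
  have hkM : M ≤ k := by have := Int.self_le_toNat M; omega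
  have hkpos : (0 : ℝ) < k := by rw [hk]; positivity
  refine exists_nsmul_mem_closure_of_mem_convexHull (k := k) (Nat.succ_pos _) ?_
  rw [← voronoi_eq_convexHull hl hint]
  refine mem_voronoi_of_forall_le fun w => ?_
  rw [map_add, map_smul, realExt_toXR, realExt_toXR, smul_eq_mul]
  have hw := (ξ.mem_Sig_iff l β).mp hβ w
  have key : w x ≤ k * (l * ξ.dualForm w w - w β) := by
    rcases hw.eq_or_lt with he | hlt
    · rw [he, sub_self, mul_zero]
      exact hx w ((mem_cells_iff hβ w).mpr he)
    · have hk1 : (1 : ℤ) ≤ k := by rw [hk]; push_cast; omega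
      by_cases h1 : l * ξ.dualForm w w ≤ w (β + x)
      · have h2 : w x ≤ M := hM ⟨w, h1, rfl⟩
        nlinarith
      · rw [map_add] at h1
        nlinarith
  have key' : ((w x : ℤ) : ℝ) ≤ k * (l * ξ.dualForm w w - w β) := by exact_mod_cast key
  have : (k : ℝ)⁻¹ * (w x : ℝ) ≤ l * ξ.dualForm w w - w β := by
    rw [inv_mul_le_iff₀ hkpos]
    exact key'
  linarith

theorem apply_sub_le {ξ : EFCDatum R K X} {l : ℕ} {β γ : X} (hβ : β ∈ ξ.Sig l)
    (hγ : γ ∈ ξ.Sig l) {w : Module.Dual ℤ X} (hw : w ∈ ξ.cells l β) : w (γ - β) ≤ 0 := by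
  rw [mem_cells_iff hβ] at hw
  have := (ξ.mem_Sig_iff l γ).mp hγ w
  rw [map_sub]
  linarith

/-- The lattice points of the local cone of `Σ_l(0)` at `β` are the points where no cell containing
`β` is positive. -/
theorem toXR_mem_cone_iff {ξ : EFCDatum R K X} {l : ℕ} (hl : 0 < l)
    (hint : IsIntegralPolytope (ξ.voronoi l 0)) {β x : X} (hβ : β ∈ ξ.Sig l) :
    toXR x ∈ ξ.cone l β ↔ ∀ w ∈ ξ.cells l β, w x ≤ 0 := by
  constructor
  · intro h w hw
    have hle : ∀ z ∈ ξ.cone l β, realExt w z ≤ 0 := by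
      intro z hz
      refine Submodule.span_induction ?_ ?_ ?_ ?_ hz
      · rintro _ ⟨γ, hγ, rfl⟩
        rw [realExt_toXR]
        exact_mod_cast apply_sub_le hβ hγ hw
      · simp
      · intro a b _ _ ha hb
        rw [map_add]
        linarith
      · intro r a _ ha
        have : realExt w (r • a) = (r : ℝ) * realExt w a := map_smul (realExt w) (r : ℝ) a
        rw [this]
        exact mul_nonpos_of_nonneg_of_nonpos r.2 ha
    have := hle _ h
    rw [realExt_toXR] at this
    exact_mod_cast this
  · intro h
    obtain ⟨d, hd, hmem⟩ := exists_nsmul_mem_closure hl hint hβ h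
    have h1 : ∀ y ∈ AddSubmonoid.closure ((fun γ => γ - β) '' ξ.Sig l), toXR y ∈ ξ.cone l β := by
      intro y hy
      refine AddSubmonoid.closure_induction ?_ ?_ ?_ hy
      · rintro _ ⟨γ, hγ, rfl⟩
        exact Submodule.subset_span ⟨γ, hγ, rfl⟩
      · rw [toXR_zero]
        exact Submodule.zero_mem _
      · intro a b _ _ ha hb
        rw [toXR_add]
        exact Submodule.add_mem _ ha hb
    have h2 := h1 _ hmem
    rw [toXR_nsmul] at h2
    have hd0 : (d : ℝ) ≠ 0 := by exact_mod_cast hd.ne'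
    have h3 := (ξ.cone l β).smul_mem (inv_nonneg.mpr (Nat.cast_nonneg d : (0 : ℝ) ≤ d)) h2
    rwa [smul_smul, inv_mul_cancel₀ hd0, one_smul] at h3

end EFCDatum

/-! ### Subalgebras of the group ring cut out by slopes -/

section Slope

variable {R K X : Type u} [CommRing R] [Field K] [Algebra R K] [AddCommGroup X]

/-- Elements `f` of `K[X]` whose coefficient at `w^x` lies in `s^{v(x)} R` for all `x`: the twisted
group ring `R[s^{v(x)} w^x]`. -/
def HasSlope (s : R) (v : Module.Dual ℤ X) (f : AddMonoidAlgebra K X) : Prop :=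
  ∀ x, ∃ r : R, f.coeff x = algebraMap R K r * (algebraMap R K s) ^ (v x)

variable [IsFractionRing R K] {s : R}

theorem algebraMap_ne_zero_of_irreducible (hs : Irreducible s) : algebraMap R K s ≠ 0 := by
  simpa using hs.ne_zero

theorem smon_mul_smon (hs : Irreducible s) (m n : ℤ) (x y : X) :
    smon K s m x * smon K s n y = smon K s (m + n) (x + y) := by
  rw [smon, smon, smon, AddMonoidAlgebra.single_mul_single,
    zpow_add₀ (algebraMap_ne_zero_of_irreducible hs)]

omit [IsFractionRing R K] in
theorem smon_pow (m : ℤ) (x : X) (n : ℕ) : smon K s m x ^ n = smon K s (n * m) (n • x) := by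
  rw [smon, smon, AddMonoidAlgebra.single_pow, mul_comm, zpow_mul, zpow_natCast]

omit [IsFractionRing R K] in
theorem smon_zero_zero : smon K s 0 (0 : X) = 1 := by
  simp [smon, AddMonoidAlgebra.one_def]

/-- The embedding `R[X] → K[X]`, `w^x ↦ s^{v(x)} w^x`. -/
noncomputable def twist (K : Type u) [Field K] [Algebra R K] [IsFractionRing R K]
    (hs : Irreducible s) (v : Module.Dual ℤ X) :
    AddMonoidAlgebra R X →ₐ[R] AddMonoidAlgebra K X :=
  AddMonoidAlgebra.lift R (AddMonoidAlgebra K X) X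
    { toFun := fun x => smon K s (v x.toAdd) x.toAdd
      map_one' := by simpa using smon_zero_zero
      map_mul' := fun x y => by rw [smon_mul_smon hs, toAdd_mul, map_add] }

theorem twist_single (hs : Irreducible s) (v : Module.Dual ℤ X) (x : X) (r : R) :
    twist K hs v (AddMonoidAlgebra.single x r) = r • smon K s (v x) x := by
  simp [twist]

theorem coeff_twist (hs : Irreducible s) (v : Module.Dual ℤ X) (f : AddMonoidAlgebra R X) (x : X) :
    (twist K hs v f).coeff x = algebraMap R K (f.coeff x) * (algebraMap R K s) ^ (v x) := by
  classical
  induction f using AddMonoidAlgebra.induction_linear with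
  | zero => simp
  | add f g hf hg => simp [hf, hg, add_mul]
  | single y r =>
    rw [twist_single, smon, AddMonoidAlgebra.coeff_smul, AddMonoidAlgebra.coeff_single,
      AddMonoidAlgebra.coeff_single, Finsupp.smul_apply, Finsupp.single_apply, Finsupp.single_apply]
    split_ifs with h
    · rw [h, Algebra.smul_def]
    · simp

theorem twist_injective (hs : Irreducible s) (v : Module.Dual ℤ X) :
    Function.Injective (twist K hs v : AddMonoidAlgebra R X → AddMonoidAlgebra K X) := by
  intro f g h
  ext x
  have h1 := congrArg (fun a => AddMonoidAlgebra.coeff a x) h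
  simp only [coeff_twist] at h1
  exact IsFractionRing.injective R K
    (mul_right_cancel₀ (zpow_ne_zero _ (algebraMap_ne_zero_of_irreducible hs)) h1)

theorem hasSlope_iff_mem_range (hs : Irreducible s) (v : Module.Dual ℤ X)
    (f : AddMonoidAlgebra K X) : HasSlope s v f ↔ f ∈ (twist K hs v).range := by
  constructor
  · intro h
    choose r hr using h
    have hs0 : ∀ x, algebraMap R K s ^ (v x) ≠ 0 := fun x =>
      zpow_ne_zero _ (algebraMap_ne_zero_of_irreducible hs)
    refine ⟨AddMonoidAlgebra.ofCoeff (Finsupp.onFinset f.coeff.support r ?_), ?_⟩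
    · intro x hx
      rw [Finsupp.mem_support_iff, hr]
      exact mul_ne_zero (by simpa using hx) (hs0 x)
    · ext x
      exact (coeff_twist hs v _ x).trans (hr x).symm
  · rintro ⟨g, rfl⟩ x
    exact ⟨g.coeff x, coeff_twist hs v g x⟩

/-- The subalgebra of the elements of `K[X]` of slope `v` for all `v ∈ V`: the elements whose
coefficient at `w^x` is divisible by `s ^ v(x)` for all `v ∈ V`. -/
noncomputable def slope (K : Type u) [Field K] [Algebra R K] [IsFractionRing R K]
    (hs : Irreducible s) (V : Set (Module.Dual ℤ X)) : Subalgebra R (AddMonoidAlgebra K X) :=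
  ⨅ v ∈ V, (twist K hs v).range

variable {V : Set (Module.Dual ℤ X)}

theorem mem_slope (hs : Irreducible s) {f : AddMonoidAlgebra K X} : f ∈ slope K hs V ↔ ∀ v ∈ V, HasSlope s v f := by
  simp only [slope, Algebra.mem_iInf, hasSlope_iff_mem_range hs]

theorem slope_singleton (hs : Irreducible s) (v : Module.Dual ℤ X) : slope K hs {v} = (twist K hs v).range := by
  simp [slope]

theorem slope_anti (hs : Irreducible s) {V' : Set (Module.Dual ℤ X)} (h : V' ⊆ V) :
    (slope K hs V : Subalgebra R (AddMonoidAlgebra K X)) ≤ slope K hs V' := fun _ hf =>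
  (mem_slope hs).mpr fun v hv => (mem_slope hs).mp hf v (h hv)

theorem adjoin_smon_eq_slope (hs : Irreducible s) (v : Module.Dual ℤ X) :
    Algebra.adjoin R {f : AddMonoidAlgebra K X | ∃ x : X, f = smon K s (v x) x} =
      slope K hs {v} := by
  rw [slope_singleton]
  apply le_antisymm
  · refine Algebra.adjoin_le ?_
    rintro _ ⟨x, rfl⟩
    exact ⟨AddMonoidAlgebra.single x 1, by simpa using twist_single (K := K) hs v x 1⟩
  · rintro _ ⟨f, rfl⟩
    change twist K hs v f ∈ _
    induction f using AddMonoidAlgebra.induction_linear with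
    | zero => rw [map_zero]; exact Subalgebra.zero_mem _
    | add f g hf hg => rw [map_add]; exact Subalgebra.add_mem _ hf hg
    | single y r =>
      rw [twist_single]
      have hy : smon K s (v y) y ∈ {f : AddMonoidAlgebra K X | ∃ x : X, f = smon K s (v x) x} :=
        ⟨y, rfl⟩
      exact Subalgebra.smul_mem _ (Algebra.subset_adjoin hy) r

theorem hasSlope_single_iff [IsDomain R] [IsDiscreteValuationRing R] (hs : Irreducible s) (v : Module.Dual ℤ X) (x : X) (c : Kˣ) :
    HasSlope s v (AddMonoidAlgebra.single x (c : K)) ↔ v x ≤ vs R c := by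
  classical
  rw [le_vs_iff hs]
  constructor
  · intro h
    simpa using h x
  · rintro ⟨r, hr⟩ y
    rw [AddMonoidAlgebra.coeff_single, Finsupp.single_apply]
    split_ifs with h
    · exact ⟨r, h ▸ hr⟩
    · exact ⟨0, by simp⟩

theorem smon_mem_slope_iff [IsDomain R] [IsDiscreteValuationRing R] (hs : Irreducible s) (n : ℤ) (x : X) :
    smon K s n x ∈ slope K hs V ↔ ∀ v ∈ V, v x ≤ n := by
  set t : Kˣ := Units.mk0 _ (algebraMap_ne_zero_of_irreducible (K := K) hs) with ht
  have h1 : smon K s n x = AddMonoidAlgebra.single x (((t ^ n : Kˣ)) : K) := by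
    simp [smon, ht]
  have h2 : vs R (t ^ n) = n := by rw [vs_zpow, vs_uniformizer hs t rfl, mul_one]
  simp only [mem_slope, h1, hasSlope_single_iff hs, h2]

/-! ### Integral closedness of the twisted group rings -/

section Integral

variable [IsDomain R] [IsDiscreteValuationRing R] [Module.Free ℤ X]

/-- Group rings of free abelian groups over a domain are domains. -/
theorem isDomain_groupRing (k : Type u) [CommRing k] [IsDomain k] :
    IsDomain (AddMonoidAlgebra k X) := by
  have : TwoUniqueSums X := TwoUniqueSums.of_injective_addHom
    (Module.Free.chooseBasis ℤ X).repr.toAddEquiv.toAddHom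
    (Module.Free.chooseBasis ℤ X).repr.injective inferInstance
  exact NoZeroDivisors.to_isDomain _

/-- `s` generates a radical ideal of `R[X]`, because `k[X]` is a domain. -/
theorem exists_eq_smul_of_pow_eq_smul (hs : Irreducible s) {g : AddMonoidAlgebra R X} {d : ℕ}
    (h : ∃ g', g ^ d = s • g') : ∃ g', g = s • g' := by
  have := isDomain_groupRing (X := X) (IsLocalRing.ResidueField R)
  set π := AddMonoidAlgebra.mapRingHom X (IsLocalRing.residue R) with hπ
  have hcoeff : ∀ (f : AddMonoidAlgebra R X) x,
      (π f).coeff x = IsLocalRing.residue R (f.coeff x) := fun f x => by simp [hπ]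
  have hs0 : IsLocalRing.residue R s = 0 := by
    rw [IsLocalRing.residue_eq_zero_iff, hs.maximalIdeal_eq]
    exact Ideal.mem_span_singleton_self s
  obtain ⟨g', hg'⟩ := h
  have h1 : π g = 0 := by
    refine eq_zero_of_pow_eq_zero (n := d) ?_
    rw [← map_pow, hg']
    ext x
    rw [hcoeff, AddMonoidAlgebra.coeff_smul, Finsupp.smul_apply, smul_eq_mul, map_mul, hs0]
    simp
  have h2 : ∀ x, ∃ r, g.coeff x = s * r := by
    intro x
    have h3 := hcoeff g x
    rw [h1] at h3
    have h4 : g.coeff x ∈ IsLocalRing.maximalIdeal R :=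
      (IsLocalRing.residue_eq_zero_iff _).mp (by simpa using h3.symm)
    rw [hs.maximalIdeal_eq, Ideal.mem_span_singleton] at h4
    exact h4
  choose r hr using h2
  refine ⟨AddMonoidAlgebra.ofCoeff (Finsupp.onFinset g.coeff.support r ?_), ?_⟩
  · intro x hx
    rw [Finsupp.mem_support_iff, hr]
    exact mul_ne_zero hs.ne_zero hx
  · ext x
    exact hr x

omit [Module.Free ℤ X] in
theorem exists_smul_hasSlope (hs : Irreducible s) (v : Module.Dual ℤ X) (f : AddMonoidAlgebra K X) :
    ∃ n : ℕ, s ^ n • f ∈ (twist K hs v).range := by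
  induction f using AddMonoidAlgebra.induction_linear with
  | zero => exact ⟨0, by rw [smul_zero]; exact Subalgebra.zero_mem _⟩
  | add f g hf hg =>
    obtain ⟨m, hm⟩ := hf
    obtain ⟨n, hn⟩ := hg
    refine ⟨m + n, ?_⟩
    rw [smul_add]
    refine Subalgebra.add_mem _ ?_ ?_
    · rw [pow_add, mul_comm, mul_smul]
      exact Subalgebra.smul_mem _ hm _
    · rw [pow_add, mul_smul]
      exact Subalgebra.smul_mem _ hn _
  | single x c =>
    by_cases hc : c = 0
    · exact ⟨0, by rw [hc, AddMonoidAlgebra.single_zero, smul_zero]; exact Subalgebra.zero_mem _⟩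
    set t : Kˣ := Units.mk0 _ (algebraMap_ne_zero_of_irreducible (K := K) hs) with ht
    set c' : Kˣ := Units.mk0 c hc with hc'
    refine ⟨(v x - vs R c').toNat, ?_⟩
    rw [← hasSlope_iff_mem_range]
    have h1 : s ^ (v x - vs R c').toNat • AddMonoidAlgebra.single x c =
        AddMonoidAlgebra.single x ((t ^ (v x - vs R c').toNat * c' : Kˣ) : K) := by
      rw [AddMonoidAlgebra.smul_single, Algebra.smul_def]
      simp [ht, hc']
    rw [h1, hasSlope_single_iff hs, vs_mul, vs_pow, vs_uniformizer hs t rfl]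
    have := Int.self_le_toNat (v x - vs R c')
    linarith

/-- The twisted group ring `R[s^{v(x)} w^x]` is integrally closed in `K[X]`: if `f` is integral
and `s^{n+1} f` lies in the ring, then a power of `s^{n+1} f` is divisible by `s` there, and `s`
generates a radical ideal. -/
theorem mem_range_twist_of_isIntegral (hs : Irreducible s) (v : Module.Dual ℤ X) {f : AddMonoidAlgebra K X}
    (hf : IsIntegral (twist K hs v).range f) : f ∈ (twist K hs v).range := by
  obtain ⟨n, hn⟩ := exists_smul_hasSlope hs v f
  -- descending in `n`, it suffices to divide `s^{n+1} f` by `s` inside the ring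
  induction n with
  | zero => simpa using hn
  | succ n ih =>
    apply ih
    obtain ⟨g, hg⟩ := hn
    replace hg : twist K hs v g = s ^ (n + 1) • f := hg
    obtain ⟨p, hp, hpf⟩ := hf
    set d := p.natDegree with hd
    have hsum : f ^ d = -∑ i ∈ Finset.range d, (p.coeff i : AddMonoidAlgebra K X) * f ^ i := by
      rw [eq_neg_iff_add_eq_zero, add_comm]
      rw [Polynomial.eval₂_eq_sum_range, Finset.sum_range_succ, ← hd,
        show p.coeff d = 1 from hp] at hpf
      simpa using hpf
    -- `(s^{n+1} f)^d` is `s` times an element of the ring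
    have hdvd : ∃ g', g ^ d = s • g' := by
      have hmem : ∀ i ∈ Finset.range d, ∃ q : AddMonoidAlgebra R X,
          twist K hs v (s • q) = (s ^ (n + 1)) ^ d • ((p.coeff i : AddMonoidAlgebra K X) * f ^ i) := by
        intro i hi
        obtain ⟨c, hc⟩ := (p.coeff i).2
        replace hc : twist K hs v c = (p.coeff i : AddMonoidAlgebra K X) := hc
        obtain ⟨e, he⟩ := Nat.exists_eq_add_of_lt (Finset.mem_range.mp hi)
        refine ⟨(s ^ n * (s ^ (n + 1)) ^ e) • (c * g ^ i), ?_⟩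
        rw [smul_smul, map_smul, map_mul, map_pow, hg, hc, smul_pow, mul_smul_comm, smul_smul]
        congr 1
        rw [he]
        ring
      choose! q hq using hmem
      refine ⟨-∑ i ∈ Finset.range d, q i, twist_injective (K := K) hs v ?_⟩
      rw [map_pow, hg, smul_pow, hsum, smul_neg, smul_neg, map_neg, Finset.smul_sum,
        Finset.smul_sum, map_sum]
      exact congrArg _ (Finset.sum_congr rfl fun i hi => (hq i hi).symm)
    obtain ⟨g', hg'⟩ := exists_eq_smul_of_pow_eq_smul hs hdvd
    refine ⟨g', ?_⟩
    change twist K hs v g' = s ^ n • f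
    rw [hg', map_smul, pow_succ', mul_smul] at hg
    have hinj : Function.Injective fun h : AddMonoidAlgebra K X => s • h := by
      intro a b hab
      ext x
      have := congrArg (fun a => AddMonoidAlgebra.coeff a x) hab
      rw [AddMonoidAlgebra.coeff_smul, AddMonoidAlgebra.coeff_smul, Finsupp.smul_apply,
        Finsupp.smul_apply, Algebra.smul_def, Algebra.smul_def] at this
      exact mul_left_cancel₀ (algebraMap_ne_zero_of_irreducible hs) this
    exact hinj hg

theorem mem_slope_of_isIntegral (hs : Irreducible s) {A : Subalgebra R (AddMonoidAlgebra K X)} (hA : A ≤ slope K hs V)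
    {f : AddMonoidAlgebra K X} (hf : IsIntegral A f) : f ∈ slope K hs V := by
  rw [mem_slope]
  intro v hv
  rw [hasSlope_iff_mem_range hs]
  refine mem_range_twist_of_isIntegral hs v ?_
  have hle : A ≤ (twist K hs v).range := fun a ha =>
    (hasSlope_iff_mem_range hs v a).mp ((mem_slope hs).mp (hA ha) v hv)
  exact hf.map_of_comp_eq (Subalgebra.inclusion hle).toRingHom (RingHom.id _) rfl

end Integral

end Slope

/-! ### Monomial bases of the slope algebras and of their closed fibres -/

section Fibre

variable {R K X : Type u} [CommRing R] [IsDomain R] [IsDiscreteValuationRing R]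
  [Field K] [Algebra R K] [IsFractionRing R K] [AddCommGroup X]
  {s : R} {V V' : Set (Module.Dual ℤ X)} {H H' : X → ℤ}

/-- `H` is the support function of `V`: its value at `x` is the maximum of the `v(x)`, `v ∈ V`. -/
def IsSupportFunction (V : Set (Module.Dual ℤ X)) (H : X → ℤ) : Prop :=
  ∀ x, IsGreatest ((fun v : Module.Dual ℤ X => v x) '' V) (H x)

theorem exists_isSupportFunction (hV : V.Finite) (hne : V.Nonempty) :
    ∃ H, IsSupportFunction V H := by
  have : ∀ x, ∃ n, IsGreatest ((fun v : Module.Dual ℤ X => v x) '' V) n := fun x =>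
    Set.exists_max_image _ id (hV.image _) (hne.image _) |>.imp fun n h => ⟨h.1, fun a ha => h.2 a ha⟩
  choose H hH using this
  exact ⟨H, hH⟩

theorem isSupportFunction_singleton (v : Module.Dual ℤ X) : IsSupportFunction {v} fun x => v x := by
  intro x
  simp

theorem IsSupportFunction.le (hH : IsSupportFunction V H) {v : Module.Dual ℤ X} (hv : v ∈ V)
    (x : X) : v x ≤ H x :=
  (hH x).2 ⟨v, hv, rfl⟩

theorem IsSupportFunction.exists_eq (hH : IsSupportFunction V H) (x : X) : ∃ v ∈ V, v x = H x :=
  (hH x).1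

theorem IsSupportFunction.map_add_le (hH : IsSupportFunction V H) (x y : X) :
    H (x + y) ≤ H x + H y := by
  obtain ⟨v, hv, h⟩ := hH.exists_eq (x + y)
  rw [← h, map_add]
  exact add_le_add (hH.le hv x) (hH.le hv y)

theorem IsSupportFunction.map_zero (hH : IsSupportFunction V H) : H 0 = 0 := by
  obtain ⟨v, -, h⟩ := hH.exists_eq 0
  rw [← h, _root_.map_zero]

theorem IsSupportFunction.mono (hH : IsSupportFunction V H) (hH' : IsSupportFunction V' H')
    (h : V' ⊆ V) (x : X) : H' x ≤ H x := by
  obtain ⟨v, hv, hx⟩ := hH'.exists_eq x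
  exact hx ▸ hH.le (h hv) x

/-- The support function is additive on `x` and `y` exactly where one `v ∈ V` is maximal at both. -/
theorem IsSupportFunction.map_add_eq_iff (hH : IsSupportFunction V H) (x y : X) :
    H (x + y) = H x + H y ↔ ∃ v ∈ V, v x = H x ∧ v y = H y := by
  constructor
  · intro h
    obtain ⟨v, hv, hxy⟩ := hH.exists_eq (x + y)
    have h1 := hH.le hv x
    have h2 := hH.le hv y
    rw [map_add] at hxy
    exact ⟨v, hv, by omega, by omega⟩
  · rintro ⟨v, hv, hx, hy⟩
    refine le_antisymm (hH.map_add_le x y) ?_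
    rw [← hx, ← hy, ← map_add]
    exact hH.le hv _

variable (hs : Irreducible s)

omit [IsDomain R] [IsDiscreteValuationRing R] in
theorem IsSupportFunction.mem_slope_iff (hH : IsSupportFunction V H) {f : AddMonoidAlgebra K X} :
    f ∈ slope K hs V ↔
      ∀ x, ∃ r : R, f.coeff x = algebraMap R K r * (algebraMap R K s) ^ (H x) := by
  have hs0 : algebraMap R K s ≠ 0 := algebraMap_ne_zero_of_irreducible hs
  rw [mem_slope]
  constructor
  · intro h x
    obtain ⟨v, hv, hx⟩ := hH.exists_eq x
    exact hx ▸ h v hv x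
  · intro h v hv x
    obtain ⟨r, hr⟩ := h x
    refine ⟨r * s ^ (H x - v x).toNat, ?_⟩
    have h1 : ((H x - v x).toNat : ℤ) = H x - v x :=
      Int.toNat_of_nonneg (sub_nonneg.mpr (hH.le hv x))
    rw [hr, map_mul, map_pow, mul_assoc, ← zpow_natCast, ← zpow_add₀ hs0, h1]
    congr 2
    ring

theorem IsSupportFunction.smon_mem (hH : IsSupportFunction V H) (x : X) :
    smon K s (H x) x ∈ slope K hs V :=
  (smon_mem_slope_iff hs _ _).mpr fun _ hv => hH.le hv x

/-- The `R`-linear combination of the monomials `s^{H(x)} w^x` with given coefficients. -/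
noncomputable def IsSupportFunction.comb (K : Type u) [Field K] [Algebra R K] [IsFractionRing R K]
    (hH : IsSupportFunction V H) : (X →₀ R) →ₗ[R] slope K hs V :=
  Finsupp.linearCombination R fun x => ⟨smon K s (H x) x, hH.smon_mem hs x⟩

theorem IsSupportFunction.coeff_comb (hH : IsSupportFunction V H) (r : X →₀ R) (x : X) :
    (hH.comb hs K r : AddMonoidAlgebra K X).coeff x =
      algebraMap R K (r x) * (algebraMap R K s) ^ (H x) := by
  classical
  induction r using Finsupp.induction_linear with
  | zero => simp
  | add f g hf hg => simp [hf, hg, add_mul]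
  | single y c =>
    rw [comb, Finsupp.linearCombination_single]
    change (c • smon K s (H y) y).coeff x = _
    rw [smon, AddMonoidAlgebra.coeff_smul, AddMonoidAlgebra.coeff_single, Finsupp.smul_apply,
      Finsupp.single_apply, Finsupp.single_apply]
    split_ifs with h
    · rw [h, Algebra.smul_def]
    · simp

theorem IsSupportFunction.comb_bijective (hH : IsSupportFunction V H) :
    Function.Bijective (hH.comb hs K) := by
  have hs0 : ∀ x, algebraMap R K s ^ (H x) ≠ 0 := fun x =>
    zpow_ne_zero _ (algebraMap_ne_zero_of_irreducible hs)
  constructor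
  · intro f g h
    ext x
    have h1 := congrArg (fun a : slope K hs V => (a : AddMonoidAlgebra K X).coeff x) h
    simp only [coeff_comb] at h1
    exact IsFractionRing.injective R K (mul_right_cancel₀ (hs0 x) h1)
  · rintro ⟨f, hf⟩
    choose r hr using (hH.mem_slope_iff hs).mp hf
    refine ⟨Finsupp.onFinset f.coeff.support r ?_, ?_⟩
    · intro x hx
      rw [Finsupp.mem_support_iff, hr]
      exact mul_ne_zero (by simpa using hx) (hs0 x)
    · apply Subtype.ext
      ext x
      exact (hH.coeff_comb hs _ x).trans (hr x).symm

/-- The basis `(s^{H(x)} w^x)_{x ∈ X}` of the `R`-module `slope K hs V`. -/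
noncomputable def IsSupportFunction.basis (K : Type u) [Field K] [Algebra R K] [IsFractionRing R K]
    (hH : IsSupportFunction V H) : Module.Basis X R (slope K hs V) :=
  .ofRepr (LinearEquiv.ofBijective (hH.comb hs K) (hH.comb_bijective hs)).symm

theorem IsSupportFunction.coe_basis (hH : IsSupportFunction V H) (x : X) :
    (hH.basis hs K x : AddMonoidAlgebra K X) = smon K s (H x) x := by
  have : hH.basis hs K x = hH.comb hs K (Finsupp.single x 1) := rfl
  rw [this, comb, Finsupp.linearCombination_single, one_smul]

theorem IsSupportFunction.coeff_eq_repr (hH : IsSupportFunction V H) (a : slope K hs V) (x : X) :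
    (a : AddMonoidAlgebra K X).coeff x =
      algebraMap R K ((hH.basis hs K).repr a x) * (algebraMap R K s) ^ (H x) := by
  have h : hH.comb hs K ((hH.basis hs K).repr a) = a := (hH.basis hs K).repr.symm_apply_apply a
  rw [← hH.coeff_comb hs, h]

omit [IsDomain R] [IsDiscreteValuationRing R] in
theorem smul_smon (hs : Irreducible s) (n : ℕ) (m : ℤ) (x : X) :
    s ^ n • smon K s m x = smon K s (n + m) x := by
  rw [smon, smon, AddMonoidAlgebra.smul_single, Algebra.smul_def, map_pow,
    zpow_add₀ (algebraMap_ne_zero_of_irreducible hs), zpow_natCast]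

theorem IsSupportFunction.basis_mul (hH : IsSupportFunction V H) (x y : X) :
    hH.basis hs K x * hH.basis hs K y =
      s ^ (H x + H y - H (x + y)).toNat • hH.basis hs K (x + y) := by
  apply Subtype.ext
  have h := Int.toNat_of_nonneg (sub_nonneg.mpr (hH.map_add_le x y))
  rw [Subalgebra.coe_mul, Subalgebra.coe_smul, coe_basis, coe_basis, coe_basis, smul_smon hs,
    smon_mul_smon hs, h, sub_add_cancel]

theorem IsSupportFunction.basis_zero (hH : IsSupportFunction V H) : hH.basis hs K 0 = 1 := by
  apply Subtype.ext
  rw [coe_basis, hH.map_zero, smon_zero_zero, Subalgebra.coe_one]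

/-- The basis of the closed fibre of `slope K hs V` given by the monomials `s^{H(x)} w^x`. -/
noncomputable def IsSupportFunction.fibreBasis (K : Type u) [Field K] [Algebra R K]
    [IsFractionRing R K] (hH : IsSupportFunction V H) :
    Module.Basis X (IsLocalRing.ResidueField R) (IsLocalRing.ResidueField R ⊗[R] slope K hs V) :=
  (hH.basis hs K).baseChange _

theorem IsSupportFunction.fibreBasis_apply (hH : IsSupportFunction V H) (x : X) :
    hH.fibreBasis hs K x = 1 ⊗ₜ hH.basis hs K x :=
  Module.Basis.baseChange_apply ..

theorem IsSupportFunction.fibreBasis_zero (hH : IsSupportFunction V H) :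
    hH.fibreBasis hs K 0 = 1 := by
  rw [fibreBasis_apply, basis_zero]
  rfl

theorem algebraMap_residueField_eq_zero (hs : Irreducible s) :
    algebraMap R (IsLocalRing.ResidueField R) s = 0 := by
  rw [IsLocalRing.ResidueField.algebraMap_eq, IsLocalRing.residue_eq_zero_iff, hs.maximalIdeal_eq]
  exact Ideal.mem_span_singleton_self s

/-- The multiplication table of the closed fibre. The exponent of `s` in the product of the
monomials at `x` and `y` is `H(x) + H(y) - H(x + y)`, and `s` vanishes in the residue field. -/
theorem IsSupportFunction.fibreBasis_mul (hH : IsSupportFunction V H) (x y : X) :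
    hH.fibreBasis hs K x * hH.fibreBasis hs K y =
      if H (x + y) = H x + H y then hH.fibreBasis hs K (x + y) else 0 := by
  rw [fibreBasis_apply, fibreBasis_apply, Algebra.TensorProduct.tmul_mul_tmul, one_mul, basis_mul]
  split_ifs with h
  · rw [h, sub_self, Int.toNat_zero, pow_zero, one_smul, fibreBasis_apply]
  · have h1 : (H x + H y - H (x + y)).toNat ≠ 0 := by
      have := hH.map_add_le x y
      omega
    rw [TensorProduct.tmul_smul, TensorProduct.smul_tmul', Algebra.smul_def, map_pow,
      algebraMap_residueField_eq_zero hs, zero_pow h1, zero_mul, TensorProduct.zero_tmul]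

/-- The homomorphism of closed fibres induced by an endomorphism of the ambient ring. -/
noncomputable def closedFibreHom {M : Type u} [CommRing M] [Algebra R M] (g : M →ₐ[R] M)
    {A₁ A₂ : Subalgebra R M} (h : A₁ ≤ A₂.comap g) :
    IsLocalRing.ResidueField R ⊗[R] A₁ →ₐ[R] IsLocalRing.ResidueField R ⊗[R] A₂ :=
  Algebra.TensorProduct.map (AlgHom.id R (IsLocalRing.ResidueField R))
    ((g.comp A₁.val).codRestrict A₂ (fun z => h z.2))

/-- The homomorphism of closed fibres induced by an inclusion of subalgebras. -/
noncomputable abbrev fibreInclHom {M : Type u} [CommRing M] [Algebra R M] {A₁ A₂ : Subalgebra R M}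
    (h : A₁ ≤ A₂) :
    IsLocalRing.ResidueField R ⊗[R] A₁ →ₐ[R] IsLocalRing.ResidueField R ⊗[R] A₂ :=
  closedFibreHom (AlgHom.id R M) (fun _ hz => h hz)

/-- Restriction to a smaller set of slopes keeps the monomials whose order does not drop and kills
the others. -/
theorem IsSupportFunction.fibreBasis_repr_fibreInclHom (hH : IsSupportFunction V H)
    (hH' : IsSupportFunction V' H') (h : V' ⊆ V) (hle : slope K hs V ≤ slope K hs V')
    (z : IsLocalRing.ResidueField R ⊗[R] slope K hs V) (x : X) :
    (hH'.fibreBasis hs K).repr (fibreInclHom hle z) x =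
      if H x = H' x then (hH.fibreBasis hs K).repr z x else 0 := by
  induction z using TensorProduct.induction_on with
  | zero => simp
  | add a b ha hb =>
    rw [map_add, map_add, map_add, Finsupp.add_apply, Finsupp.add_apply, ha, hb]
    split_ifs <;> simp
  | tmul c a =>
    have hs0 : algebraMap R K s ≠ 0 := algebraMap_ne_zero_of_irreducible hs
    have hn := Int.toNat_of_nonneg (sub_nonneg.mpr (hH.mono hH' h x))
    have key : (hH'.basis hs K).repr ⟨a, hle a.2⟩ x =
        s ^ (H x - H' x).toNat * (hH.basis hs K).repr a x := by
      have h1 := hH.coeff_eq_repr hs a x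
      have h2 := hH'.coeff_eq_repr hs ⟨a, hle a.2⟩ x
      apply IsFractionRing.injective R K
      apply mul_right_cancel₀ (zpow_ne_zero (H' x) hs0)
      rw [← h2, h1, map_mul, map_pow, mul_right_comm, ← zpow_natCast, ← zpow_add₀ hs0, hn,
        sub_add_cancel, mul_comm]
    change (hH'.fibreBasis hs K).repr (c ⊗ₜ ⟨a, hle a.2⟩) x = _
    rw [fibreBasis, fibreBasis, Module.Basis.baseChange_repr_tmul,
      Module.Basis.baseChange_repr_tmul, key]
    split_ifs with h4
    · rw [h4, sub_self, Int.toNat_zero, pow_zero, one_mul]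
    · have h5 : (H x - H' x).toNat ≠ 0 := by
        have := hH.mono hH' h x
        omega
      rw [mul_smul, Algebra.smul_def, map_pow, algebraMap_residueField_eq_zero hs, zero_pow h5,
        zero_mul]

/-- The closed fibre of a twisted group ring is a domain, being isomorphic to `k[X]`. -/
theorem isDomain_fibre_singleton [Module.Free ℤ X] (v : Module.Dual ℤ X) :
    IsDomain (IsLocalRing.ResidueField R ⊗[R] slope K hs {v}) := by
  have := isDomain_groupRing (X := X) (IsLocalRing.ResidueField R)
  rw [slope_singleton]
  let e₁ := AlgEquiv.ofInjective (twist K hs v) (twist_injective hs v)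
  let e₂ := (Algebra.TensorProduct.congr
    (AlgEquiv.refl : IsLocalRing.ResidueField R ≃ₐ[R] IsLocalRing.ResidueField R) e₁.symm).trans
    ((AddMonoidAlgebra.scalarTensorEquiv R (IsLocalRing.ResidueField R)).restrictScalars R)
  exact e₂.toMulEquiv.isDomain _

/-! ### Slope algebras of subsets as localizations -/

theorem isOpenImmersion_of_localization {A B : Type u} [CommRing A] [CommRing B] (f : A →+* B)
    (m : A) (hu : IsUnit (f m)) (hsurj : ∀ b, ∃ (n : ℕ) (a : A), b * f m ^ n = f a)
    (hker : ∀ a, f a = 0 → ∃ n : ℕ, m ^ n * a = 0) :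
    IsOpenImmersion (Spec.map (CommRingCat.ofHom f)) := by
  algebraize [f]
  have : IsLocalization.Away m B := by
    refine IsLocalization.Away.mk m hu hsurj fun a b hab => ?_
    obtain ⟨n, hn⟩ := hker (a - b) (by rw [map_sub]; exact sub_eq_zero.mpr hab)
    exact ⟨n, sub_eq_zero.mp (by rw [← mul_sub, hn])⟩
  exact IsOpenImmersion.of_isLocalization m

omit [IsDomain R] [IsDiscreteValuationRing R] in
/-- Multiplication by a high power of a monomial at which `v` is strictly maximal in `V` moves
elements of slope `v` into the slope algebra of `V`. -/
theorem exists_mul_pow_mem_slope (hV : V.Finite) {v : Module.Dual ℤ X} {x₀ : X}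
    (hx₀ : ∀ v' ∈ V, v' ≠ v → v' x₀ < v x₀) {f : AddMonoidAlgebra K X}
    (hf : f ∈ slope K hs {v}) : ∃ n : ℕ, f * smon K s (v x₀) x₀ ^ n ∈ slope K hs V := by
  have hs0 : algebraMap R K s ≠ 0 := algebraMap_ne_zero_of_irreducible hs
  have hf' := (mem_slope hs).mp hf v rfl
  obtain ⟨M, hM⟩ := ((hV.prod f.coeff.support.finite_toSet).image
    fun p : Module.Dual ℤ X × X => p.1 p.2 - v p.2).bddAbove
  refine ⟨M.toNat, (mem_slope hs).mpr fun v' hv' y => ?_⟩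
  set k := M.toNat
  have hk : M ≤ k := Int.self_le_toNat M
  rw [smon_pow, mul_comm, smon, AddMonoidAlgebra.coeff_single_mul_apply]
  set x := -(k • x₀) + y with hx
  obtain ⟨r, hr⟩ := hf' x
  by_cases h0 : f.coeff x = 0
  · exact ⟨0, by simp [h0]⟩
  have hxM : v' x - v x ≤ M := hM ⟨(v', x), ⟨hv', by simpa using h0⟩, rfl⟩
  have hy : y = x + k • x₀ := by rw [hx]; abel
  have hle : v' y ≤ k * v x₀ + v x := by
    rw [hy, map_add, map_nsmul, nsmul_eq_mul]
    by_cases hvv : v' = v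
    · rw [hvv]; linarith
    · have h1 := hx₀ v' hv' hvv
      nlinarith [Int.natCast_nonneg k]
  obtain ⟨n, hn⟩ := Int.eq_ofNat_of_zero_le (sub_nonneg.mpr hle)
  refine ⟨r * s ^ n, ?_⟩
  rw [hr, map_mul, map_pow, mul_assoc, ← zpow_natCast, ← zpow_add₀ hs0, mul_left_comm,
    ← zpow_add₀ hs0, ← hn]
  congr 2
  ring

section Away

variable {v : Module.Dual ℤ X} {x₀ : X}

theorem smon_mem_slope_of_lt (hx₀ : ∀ v' ∈ V, v' ≠ v → v' x₀ < v x₀) :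
    smon K s (v x₀) x₀ ∈ slope K hs V := by
  refine (smon_mem_slope_iff hs _ _).mpr fun v' hv' => ?_
  by_cases h : v' = v
  · rw [h]
  · exact (hx₀ v' hv' h).le

theorem isUnit_smon (h : smon K s (v x₀) x₀ ∈ slope K hs {v}) :
    IsUnit (⟨smon K s (v x₀) x₀, h⟩ : slope K hs {v}) := by
  have h' : smon K s (-v x₀) (-x₀) ∈ slope K hs {v} :=
    (smon_mem_slope_iff hs _ _).mpr fun v' hv' => by rw [hv', map_neg]
  refine IsUnit.of_mul_eq_one ⟨_, h'⟩ (Subtype.ext ?_)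
  rw [Subalgebra.coe_mul, smon_mul_smon hs, add_neg_cancel, add_neg_cancel, smon_zero_zero,
    Subalgebra.coe_one]

theorem isOpenImmersion_specIncl (hV : V.Finite)
    (hx₀ : ∀ v' ∈ V, v' ≠ v → v' x₀ < v x₀) (hle : slope K hs V ≤ slope K hs {v}) :
    IsOpenImmersion (specIncl hle).left := by
  refine isOpenImmersion_of_localization (Subalgebra.inclusion hle).toRingHom
    ⟨smon K s (v x₀) x₀, smon_mem_slope_of_lt hs hx₀⟩ (isUnit_smon hs _) ?_ ?_
  · intro f
    obtain ⟨n, hn⟩ := exists_mul_pow_mem_slope hs hV hx₀ f.2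
    exact ⟨n, ⟨_, hn⟩, rfl⟩
  · intro a ha
    exact ⟨0, by rw [(Subalgebra.inclusion_injective hle) (ha.trans (map_zero _).symm), mul_zero]⟩

theorem isOpenImmersion_fibreIncl (hV : V.Finite) (hv : v ∈ V)
    (hx₀ : ∀ v' ∈ V, v' ≠ v → v' x₀ < v x₀) (hle : slope K hs V ≤ slope K hs {v}) :
    IsOpenImmersion (fibreIncl hle) := by
  obtain ⟨H, hH⟩ := exists_isSupportFunction hV ⟨v, hv⟩
  have hsub : {v} ⊆ V := Set.singleton_subset_iff.mpr hv
  have hHx₀ : H x₀ = v x₀ := by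
    obtain ⟨v', hv', h⟩ := hH.exists_eq x₀
    by_cases hvv : v' = v
    · rw [← h, hvv]
    · exact absurd (hH.le hv x₀) (by rw [← h]; exact not_le.mpr (hx₀ v' hv' hvv))
  have hm : (1 : IsLocalRing.ResidueField R) ⊗ₜ[R]
      (⟨smon K s (v x₀) x₀, smon_mem_slope_of_lt hs hx₀⟩ : slope K hs V) =
      hH.fibreBasis hs K x₀ := by
    rw [hH.fibreBasis_apply]
    congr 1
    apply Subtype.ext
    rw [hH.coe_basis, hHx₀]
  refine isOpenImmersion_of_localization (fibreInclHom hle).toRingHom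
    (1 ⊗ₜ ⟨smon K s (v x₀) x₀, smon_mem_slope_of_lt hs hx₀⟩) ?_ ?_ ?_
  · exact (isUnit_smon hs (hle (smon_mem_slope_of_lt hs hx₀))).map
      (Algebra.TensorProduct.includeRight :
        slope K hs {v} →ₐ[R] IsLocalRing.ResidueField R ⊗[R] slope K hs {v})
  · intro z
    obtain ⟨f, rfl⟩ := TensorProduct.mk_surjective R (slope K hs {v}) (IsLocalRing.ResidueField R)
      IsLocalRing.residue_surjective z
    obtain ⟨n, hn⟩ := exists_mul_pow_mem_slope hs hV hx₀ f.2
    refine ⟨n, 1 ⊗ₜ ⟨_, hn⟩, ?_⟩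
    change (1 ⊗ₜ f) * (1 ⊗ₜ _) ^ n = _
    rw [Algebra.TensorProduct.tmul_pow, Algebra.TensorProduct.tmul_mul_tmul, one_pow, one_mul]
    rfl
  · intro z hz
    refine ⟨1, ?_⟩
    have hrepr : ∀ x, H x = v x → (hH.fibreBasis hs K).repr z x = 0 := by
      intro x hx
      have h1 := hH.fibreBasis_repr_fibreInclHom hs (isSupportFunction_singleton v) hsub hle z x
      rw [if_pos hx] at h1
      rw [← h1]
      change ((isSupportFunction_singleton v).fibreBasis hs K).repr
        ((fibreInclHom hle).toRingHom z) x = 0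
      rw [hz, map_zero, Finsupp.zero_apply]
    rw [pow_one, hm, ← (hH.fibreBasis hs K).linearCombination_repr z,
      Finsupp.linearCombination_apply, Finsupp.sum, Finset.mul_sum]
    refine Finset.sum_eq_zero fun x hx => ?_
    rw [mul_smul_comm, hH.fibreBasis_mul hs, if_neg, smul_zero]
    intro hadd
    obtain ⟨v', hv', h1, h2⟩ := (hH.map_add_eq_iff _ _).mp hadd
    have hvv : v' = v := by
      by_contra hvv
      exact (hx₀ v' hv' hvv).ne (h1.trans hHx₀)
    rw [Finsupp.mem_support_iff] at hx
    exact hx (hrepr x (by rw [← h2, hvv]))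

end Away

end Fibre

/-! ### Irreducible components of the closed fibre -/

/-- If finitely many irreducible open sets have dense union, then their closures are the irreducible
components. -/
theorem irreducibleComponents_eq_of_isOpen {T ι : Type*} [TopologicalSpace T] {V : Set ι}
    (hV : V.Finite) (U : ι → Set T) (hopen : ∀ v ∈ V, IsOpen (U v))
    (hirr : ∀ v ∈ V, IsIrreducible (U v)) (hcover : ∀ t, ∃ v ∈ V, t ∈ closure (U v)) :
    irreducibleComponents T = {Z | ∃ v ∈ V, Z = closure (U v)} := by
  have hmax : ∀ v ∈ V, closure (U v) ∈ irreducibleComponents T := by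
    refine fun v hv => ⟨(hirr v hv).closure, fun Z hZ hle => ?_⟩
    obtain ⟨t, ht⟩ := (hirr v hv).nonempty
    have h := subset_closure_inter_of_isPreirreducible_of_isOpen hZ.isPreirreducible (hopen v hv)
      ⟨t, hle (subset_closure ht), ht⟩
    exact h.trans (closure_mono Set.inter_subset_right)
  ext Z
  constructor
  · intro hZ
    have h := isIrreducible_iff_sUnion_isClosed.mp hZ.1 ((hV.image fun v => closure (U v)).toFinset)
      (by simp) (fun t _ => by simpa using hcover t)
    obtain ⟨_, hz, hle⟩ := h
    simp only [Set.Finite.mem_toFinset, Set.mem_image] at hz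
    obtain ⟨v, hv, rfl⟩ := hz
    exact ⟨v, hv, hle.antisymm (hZ.2 (hmax v hv).1 hle)⟩
  · rintro ⟨v, hv, rfl⟩
    exact hmax v hv

section Components

variable {R K X : Type u} [CommRing R] [IsDomain R] [IsDiscreteValuationRing R]
  [Field K] [Algebra R K] [IsFractionRing R K] [AddCommGroup X] [Module.Free ℤ X]
  {s : R} (hs : Irreducible s) {V : Set (Module.Dual ℤ X)}

/-- The closed fibres of the localizations `slope K hs {v}` cover a dense part of the closed fibre
of `slope K hs V`: a monomial dies in the closed fibre for `v` only if `v` is not maximal at it, so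
the kernels of the restriction maps meet in `0`. -/
theorem irreducibleComponents_closedFibre_slope (hV : V.Finite) (hne : V.Nonempty)
    (hx₀ : ∀ v ∈ V, ∃ x₀ : X, ∀ v' ∈ V, v' ≠ v → v' x₀ < v x₀)
    (A : Subalgebra R (AddMonoidAlgebra K X)) (hA : A = slope K hs V)
    (C : Module.Dual ℤ X → Subalgebra R (AddMonoidAlgebra K X))
    (hC : ∀ v ∈ V, C v = slope K hs {v}) :
    irreducibleComponents (closedFibre A) =
      {Z | ∃ v ∈ V, ∃ h : A ≤ C v, Z = closure (Set.range (fibreIncl h))} := by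
  subst hA
  obtain ⟨H, hH⟩ := exists_isSupportFunction hV hne
  have hle : ∀ v ∈ V, slope K hs V ≤ slope K hs {v} := fun v hv =>
    slope_anti hs (Set.singleton_subset_iff.mpr hv)
  classical
  let U : Module.Dual ℤ X → Set (closedFibre (slope K hs V)) := fun v =>
    if h : v ∈ V then Set.range (fibreIncl (hle v h)) else ∅
  have hU : ∀ v (hv : v ∈ V), U v = Set.range (fibreIncl (hle v hv)) := fun v hv => dif_pos hv
  have key := irreducibleComponents_eq_of_isOpen hV U ?_ ?_ ?_
  · rw [key]
    ext Z
    refine exists_congr fun v => and_congr_right fun hv => ?_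
    rw [hU v hv, hC v hv]
    exact ⟨fun h => ⟨hle v hv, h⟩, fun ⟨_, h⟩ => h⟩
  · intro v hv
    obtain ⟨x₀, hx⟩ := hx₀ v hv
    have := isOpenImmersion_fibreIncl hs hV hv hx (hle v hv)
    rw [hU v hv]
    exact (fibreIncl (hle v hv)).isOpenEmbedding.isOpen_range
  · intro v hv
    have := isDomain_fibre_singleton (K := K) hs v
    have hirr : IrreducibleSpace (closedFibre (slope K hs {v})) :=
      inferInstanceAs (IrreducibleSpace
        (PrimeSpectrum (IsLocalRing.ResidueField R ⊗[R] slope K hs {v})))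
    rw [hU v hv, ← Set.image_univ]
    exact (IrreducibleSpace.isIrreducible_univ _).image _
      (fibreIncl (hle v hv)).continuous.continuousOn
  · intro t
    let P : PrimeSpectrum (IsLocalRing.ResidueField R ⊗[R] slope K hs V) := t
    let I : Module.Dual ℤ X → Ideal (IsLocalRing.ResidueField R ⊗[R] slope K hs V) := fun v =>
      if h : v ∈ V then RingHom.ker (fibreInclHom (hle v h)).toRingHom else ⊤
    have hI : ∀ v (hv : v ∈ V), I v = RingHom.ker (fibreInclHom (hle v hv)).toRingHom :=
      fun v hv => dif_pos hv
    have hinf : hV.toFinset.inf I ≤ P.asIdeal := by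
      intro z hz
      have hz0 : z = 0 := by
        apply (hH.fibreBasis hs K).repr.injective
        ext x
        obtain ⟨v, hv, hx⟩ := hH.exists_eq x
        have hzv : z ∈ I v := Finset.inf_le (f := I) (hV.mem_toFinset.mpr hv) hz
        rw [hI v hv] at hzv
        have h1 := hH.fibreBasis_repr_fibreInclHom hs (isSupportFunction_singleton v)
          (Set.singleton_subset_iff.mpr hv) (hle v hv) z x
        rw [if_pos hx.symm] at h1
        have h2 : fibreInclHom (hle v hv) z = 0 := hzv
        rw [← h1, h2]
        simp
      rw [hz0]
      exact P.asIdeal.zero_mem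
    obtain ⟨v, hv, hvP⟩ := (P.isPrime.inf_le').mp hinf
    rw [hV.mem_toFinset] at hv
    refine ⟨v, hv, ?_⟩
    rw [hU v hv]
    rw [hI v hv] at hvP
    have h1 := PrimeSpectrum.closure_range_comap (fibreInclHom (hle v hv)).toRingHom
    have h2 : P ∈ closure (Set.range (PrimeSpectrum.comap (fibreInclHom (hle v hv)).toRingHom)) := by
      rw [h1]
      exact hvP
    exact h2

end Components

/-! ### Translation of closed fibres -/

section Translation

variable {R M : Type u} [CommRing R] [IsLocalRing R] [CommRing M] [Algebra R M]

theorem closedFibreMap_comp {A₁ A₂ A₃ : Subalgebra R M} (g₁ g₂ g : M →ₐ[R] M)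
    (h₁ : A₁ ≤ A₂.comap g₁) (h₂ : A₂ ≤ A₃.comap g₂) (h : A₁ ≤ A₃.comap g)
    (hg : ∀ a ∈ A₁, g₂ (g₁ a) = g a) :
    closedFibreMap g₂ h₂ ≫ closedFibreMap g₁ h₁ = closedFibreMap g h := by
  rw [closedFibreMap, closedFibreMap, closedFibreMap, ← Spec.map_comp, ← CommRingCat.ofHom_comp]
  congr 2
  refine RingHom.ext fun z => ?_
  induction z using TensorProduct.induction_on with
  | zero => simp only [map_zero]
  | add a b ha hb => rw [map_add, map_add, ha, hb]
  | tmul c a =>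
    change c ⊗ₜ (⟨g₂ (g₁ a), _⟩ : A₃) = c ⊗ₜ (⟨g a, _⟩ : A₃)
    congr 1
    exact Subtype.ext (hg a a.2)

theorem closedFibreMap_id {A : Subalgebra R M} (g : M →ₐ[R] M) (h : A ≤ A.comap g)
    (hg : ∀ a ∈ A, g a = a) : closedFibreMap g h = 𝟙 (closedFibre A) := by
  rw [closedFibreMap, ← Spec.map_id, ← CommRingCat.ofHom_id]
  congr 2
  refine RingHom.ext fun z => ?_
  induction z using TensorProduct.induction_on with
  | zero => simp only [map_zero]
  | add a b ha hb => rw [map_add, map_add, ha, hb]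
  | tmul c a =>
    change c ⊗ₜ (⟨g a, _⟩ : A) = c ⊗ₜ a
    congr 1
    exact Subtype.ext (hg a a.2)

/-- An endomorphism `g` that identifies `A₂` with `A₂'` and maps `A₁` to `A₁'` translates the image
of the closed fibre of `A₂'` to that of `A₂`. -/
theorem range_fibreIncl_eq_image {A₁ A₂ A₁' A₂' : Subalgebra R M} (h : A₁ ≤ A₂) (h' : A₁' ≤ A₂')
    (g g' : M →ₐ[R] M) (hg₁ : A₁ ≤ A₁'.comap g) (hg₂ : A₂ ≤ A₂'.comap g)
    (hg' : A₂' ≤ A₂.comap g') (hinv : ∀ a, g' (g a) = a) :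
    Set.range (fibreIncl h) = closedFibreMap g hg₁ '' Set.range (fibreIncl h') := by
  have hcomm : fibreIncl h' ≫ closedFibreMap g hg₁ = closedFibreMap g hg₂ ≫ fibreIncl h := by
    exact (closedFibreMap_comp g (AlgHom.id R M) g hg₁ (fun _ hz => h' hz)
      (fun _ ha => hg₂ (h ha)) (fun _ _ => rfl)).trans
      (closedFibreMap_comp (AlgHom.id R M) g g (fun _ hz => h hz) hg₂
        (fun _ ha => hg₂ (h ha)) (fun _ _ => rfl)).symm
  have hid : closedFibreMap g' hg' ≫ closedFibreMap g hg₂ = 𝟙 _ := by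
    rw [closedFibreMap_comp g g' (g'.comp g) _ _ (fun a ha => hg' (hg₂ ha)) (fun _ _ => rfl)]
    exact closedFibreMap_id _ _ fun a _ => hinv a
  have hsurj : Function.Surjective (closedFibreMap g hg₂) := fun t =>
    ⟨closedFibreMap g' hg' t, by rw [← Scheme.Hom.comp_apply, hid]; rfl⟩
  have hfun : (closedFibreMap g hg₁ : _ → _) ∘ (fibreIncl h' : _ → _) =
      (fibreIncl h : _ → _) ∘ (closedFibreMap g hg₂ : _ → _) := by
    funext t
    rw [Function.comp_apply, Function.comp_apply, ← Scheme.Hom.comp_apply, hcomm,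
      Scheme.Hom.comp_apply]
  rw [← Set.range_comp, hfun, hsurj.range_comp]

end Translation

/-! ### Presentations of algebras with a monomial basis -/

/-- Let `e` be a basis of a `k`-algebra `F`, indexed by `X`, that is the image of the variables of a
polynomial ring under `T_p ↦ e (π p)`. If modulo an ideal `I` of relations every product of two
variables, and `1`, are equal to the linear forms prescribed by the multiplication of `F`, then `I`
is the ideal of all relations. -/
theorem ker_aeval_eq_of_mul_mem {k F ι X : Type*} [Field k] [CommRing F] [Algebra k F]
    (e : Module.Basis X k F) (π : ι → X) (sec : X → ι) {o : X} (ho : e o = 1)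
    (I : Ideal (MvPolynomial ι k))
    (hI : I ≤ RingHom.ker (MvPolynomial.aeval (R := k) fun p => e (π p)))
    (hone : MvPolynomial.X (sec o) - 1 ∈ I)
    (hmul : ∀ x p, MvPolynomial.X (sec x) * MvPolynomial.X p -
      e.constr k (fun x => (MvPolynomial.X (sec x) : MvPolynomial ι k)) (e x * e (π p)) ∈ I) :
    RingHom.ker (MvPolynomial.aeval (R := k) fun p => e (π p)) = I := by
  refine le_antisymm (fun f hf => ?_) hI
  set S : F →ₗ[k] MvPolynomial ι k :=
    e.constr k (fun x => (MvPolynomial.X (sec x) : MvPolynomial ι k)) with hS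
  have hSe : ∀ x, S (e x) = MvPolynomial.X (sec x) := fun x => e.constr_basis k _ x
  have hmul' : ∀ (z : F) p, S z * MvPolynomial.X p - S (z * e (π p)) ∈ I := by
    intro z p
    refine Submodule.span_induction ?_ ?_ ?_ ?_ (e.mem_span z)
    · rintro _ ⟨x, rfl⟩
      rw [hSe]
      exact hmul x p
    · simp
    · intro a b _ _ ha hb
      convert I.add_mem ha hb using 1
      rw [map_add, add_mul, add_mul, map_add]
      ring
    · intro c a _ ha
      convert I.mul_mem_left (MvPolynomial.C c) ha using 1
      rw [map_smul, smul_mul_assoc, smul_mul_assoc, map_smul, MvPolynomial.smul_eq_C_mul,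
        MvPolynomial.smul_eq_C_mul]
      ring
  have key : ∀ f : MvPolynomial ι k,
      f - S (MvPolynomial.aeval (R := k) (fun p => e (π p)) f) ∈ I := by
    intro f
    induction f using MvPolynomial.induction_on with
    | C a =>
      have h1 : S (MvPolynomial.aeval (R := k) (fun p => e (π p)) (MvPolynomial.C a)) =
          MvPolynomial.C a * MvPolynomial.X (sec o) := by
        rw [MvPolynomial.aeval_C, Algebra.algebraMap_eq_smul_one, ← ho, map_smul, hSe,
          MvPolynomial.smul_eq_C_mul]
      rw [h1, show (MvPolynomial.C a : MvPolynomial ι k) - MvPolynomial.C a * MvPolynomial.X (sec o)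
        = -MvPolynomial.C a * (MvPolynomial.X (sec o) - 1) by ring]
      exact I.mul_mem_left _ hone
    | add f g hf hg =>
      rw [map_add, map_add, add_sub_add_comm]
      exact I.add_mem hf hg
    | mul_X f p hf =>
      rw [map_mul, MvPolynomial.aeval_X]
      have h1 := I.add_mem (I.mul_mem_right (MvPolynomial.X p) hf)
        (hmul' (MvPolynomial.aeval (R := k) (fun p => e (π p)) f) p)
      convert h1 using 1
      ring
  have h := key f
  rw [show MvPolynomial.aeval (R := k) (fun p => e (π p)) f = 0 from hf, map_zero, sub_zero] at h
  exact h

/-! ### The charts as slope algebras -/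

namespace EFCDatum

variable {R K X : Type u} [CommRing R] [IsDomain R] [IsDiscreteValuationRing R]
  [Field K] [Algebra R K] [IsFractionRing R K] [AddCommGroup X]

/-- The slopes of the chart `W_{l,α,u}`: the vectors `v_β + u` for `β ∈ Σ_l^α`. -/
def slopes (ξ : EFCDatum R K X) (l : ℕ) (α : X) (u : Module.Dual ℤ X) : Set (Module.Dual ℤ X) :=
  (fun v => v + u) '' ξ.cells l α

theorem slopes_sub (ξ : EFCDatum R K X) (l : ℕ) (α : X) (u v : Module.Dual ℤ X) :
    ξ.slopes l (α - (2 * l) • (ξ.phi v : X)) u = (fun n => n - v) '' ξ.slopes l α u := by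
  ext n
  constructor
  · rintro ⟨w, hw, rfl⟩
    exact ⟨v + w + u, ⟨v + w, (ξ.add_mem_cells_iff l α v w).mp hw, rfl⟩, by simp only; abel⟩
  · rintro ⟨_, ⟨w, hw, rfl⟩, rfl⟩
    refine ⟨w - v, (ξ.add_mem_cells_iff l α v _).mpr ?_, by simp only; abel⟩
    rwa [add_sub_cancel]

variable [Module.Free ℤ X] [Module.Finite ℤ X]

theorem slopes_finite {ξ : EFCDatum R K X} {l : ℕ} (hl : 0 < l) {α : X} (hα : α ∈ ξ.Sig l)
    (u : Module.Dual ℤ X) : (ξ.slopes l α u).Finite :=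
  (cells_finite hl hα).image _

omit [Module.Free ℤ X] [Module.Finite ℤ X] in
theorem slopes_nonempty {ξ : EFCDatum R K X} {l : ℕ} {α : X} (hα : α ∈ ξ.Sig l)
    (u : Module.Dual ℤ X) : (ξ.slopes l α u).Nonempty :=
  ⟨_, 0, zero_mem_cells hα, rfl⟩

theorem zero_mem_Sig (ξ : EFCDatum R K X) (l : ℕ) : (0 : X) ∈ ξ.Sig l := by
  rw [mem_Sig_iff]
  intro w
  rw [map_zero]
  exact mul_nonneg (Int.natCast_nonneg l) (ξ.dualForm_self_nonneg w)

theorem cells_zero {ξ : EFCDatum R K X} {l : ℕ} (hl : 0 < l) : ξ.cells l 0 = {0} := by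
  refine Set.eq_singleton_iff_unique_mem.mpr ⟨zero_mem_cells (ξ.zero_mem_Sig l), fun w hw => ?_⟩
  rw [mem_cells_iff (ξ.zero_mem_Sig l), map_zero] at hw
  by_contra hw0
  have h1 := ξ.dualForm_self_pos hw0
  have h2 : (0 : ℤ) < l := by exact_mod_cast hl
  exact (mul_pos h2 h1).ne hw

theorem slopes_zero {ξ : EFCDatum R K X} {l : ℕ} (hl : 0 < l) (u : Module.Dual ℤ X) :
    ξ.slopes l 0 u = {u} := by
  rw [slopes, cells_zero hl, Set.image_singleton, zero_add]

/-- Each slope of a chart is strictly maximal at the vector that points from `α` to the centre of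
the corresponding Voronoi polytope. -/
theorem lt_of_mem_slopes {ξ : EFCDatum R K X} {l : ℕ} (hl : 0 < l) {α : X}
    (u : Module.Dual ℤ X) {v : Module.Dual ℤ X} (hv : v ∈ ξ.cells l α) :
    ∀ n ∈ ξ.slopes l α u, n ≠ v + u →
      n (-(α - (2 * l) • (ξ.phi v : X))) < (v + u) (-(α - (2 * l) • (ξ.phi v : X))) := by
  rintro _ ⟨w, hw, rfl⟩ hne
  have hwv : w - v ≠ 0 := fun h => hne (by rw [sub_eq_zero.mp h])
  have hcell : w - v ∈ ξ.cells l (α - (2 * l) • (ξ.phi v : X)) :=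
    (ξ.add_mem_cells_iff l α v _).mpr (by rwa [add_sub_cancel])
  rw [mem_cells_iff hv, LinearMap.sub_apply] at hcell
  have h1 := ξ.dualForm_self_pos hwv
  have h2 : (0 : ℤ) < l := by exact_mod_cast hl
  have h3 := mul_pos h2 h1
  simp only [LinearMap.add_apply, map_neg]
  linarith

/-- The coefficient of the monomial `ξ_{l,α,v}`. -/
noncomputable def monCoeff (ξ : EFCDatum R K X) (l : ℕ) (α : X) (v : Module.Dual ℤ X) : Kˣ :=
  ξ.eps v ^ l * ξ.be v α

omit [Module.Free ℤ X] [Module.Finite ℤ X] in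
theorem mon_eq (ξ : EFCDatum R K X) (l : ℕ) (α : X) (v : Module.Dual ℤ X) :
    ξ.mon l α v = AddMonoidAlgebra.single (α + (2 * l) • (ξ.phi v : X)) (ξ.monCoeff l α v : K) :=
  rfl

theorem vs_monCoeff (ξ : EFCDatum R K X) (l : ℕ) (α : X) (v : Module.Dual ℤ X) :
    vs R (ξ.monCoeff l α v) = l * ξ.dualForm v v + v α := by
  rw [monCoeff, vs_mul, vs_pow, vs_be, eps, vs_be, dualForm]

omit [Module.Free ℤ X] [Module.Finite ℤ X] in
theorem mul_mon_eq_mon_iff (ξ : EFCDatum R K X) (l : ℕ) (α γ : X) (u w : Module.Dual ℤ X)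
    (f : AddMonoidAlgebra K X) :
    f * ξ.mon l α u = ξ.mon l γ w ↔
      f = AddMonoidAlgebra.single
        (γ + (2 * l) • (ξ.phi w : X) - (α + (2 * l) • (ξ.phi u : X)))
        ((ξ.monCoeff l γ w * (ξ.monCoeff l α u)⁻¹ : Kˣ) : K) := by
  constructor
  · intro h
    have h1 := congrArg (fun g => g * AddMonoidAlgebra.single (-(α + (2 * l) • (ξ.phi u : X)))
      (((ξ.monCoeff l α u)⁻¹ : Kˣ) : K)) h
    simp only [mon_eq, mul_assoc, AddMonoidAlgebra.single_mul_single, add_neg_cancel,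
      Units.mul_inv] at h1
    rw [← AddMonoidAlgebra.one_def, mul_one, ← sub_eq_add_neg, ← Units.val_mul] at h1
    exact h1
  · rintro rfl
    rw [mon_eq, mon_eq, AddMonoidAlgebra.single_mul_single, sub_add_cancel, ← Units.val_mul,
      inv_mul_cancel_right]

/-- The generators of `A_{l,α,u}` lie on or above the slopes `v + u` of the chart. The difference of
the two sides is `E_l(w - v - u) + (w - v - u)(γ)`. -/
theorem apply_le_vs_generator {ξ : EFCDatum R K X} {l : ℕ} {α γ : X} (hα : α ∈ ξ.Sig l)
    (hγ : γ ∈ ξ.Sig l) {v : Module.Dual ℤ X} (hv : v ∈ ξ.cells l α) (u w : Module.Dual ℤ X) :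
    (v + u) (γ + (2 * l) • (ξ.phi w : X) - (α + (2 * l) • (ξ.phi u : X))) ≤
      vs R (ξ.monCoeff l γ w * (ξ.monCoeff l α u)⁻¹) := by
  have h1 := (ξ.mem_Sig_iff l γ).mp hγ (v + u - w)
  rw [mem_cells_iff hα] at hv
  rw [vs_mul, vs_inv, vs_monCoeff, vs_monCoeff]
  have hD : ∀ a b : Module.Dual ℤ X, a (ξ.phi b : X) = ξ.dualForm a b := fun _ _ => rfl
  simp only [sub_eq_add_neg, dualForm_add_left, dualForm_add_right, dualForm_neg_left,
    dualForm_neg_right, LinearMap.add_apply, LinearMap.neg_apply, map_add, map_neg, map_nsmul,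
    nsmul_eq_mul, hD] at h1 ⊢
  rw [ξ.dualForm_comm w v, ξ.dualForm_comm w u, ξ.dualForm_comm u v] at h1
  push_cast
  linarith

/-- The generators of `A_{l,α,u}` that come from the Voronoi polytope of slope `v + u` lie exactly
on that slope. -/
theorem vs_generator_eq {ξ : EFCDatum R K X} {l : ℕ} {α : X} (hα : α ∈ ξ.Sig l) (γ : X)
    {v : Module.Dual ℤ X} (hv : v ∈ ξ.cells l α) (u : Module.Dual ℤ X) :
    vs R (ξ.monCoeff l γ (v + u) * (ξ.monCoeff l α u)⁻¹) =
      (v + u) (γ + (2 * l) • (ξ.phi (v + u) : X) - (α + (2 * l) • (ξ.phi u : X))) := by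
  rw [mem_cells_iff hα] at hv
  rw [vs_mul, vs_inv, vs_monCoeff, vs_monCoeff]
  have hD : ∀ a b : Module.Dual ℤ X, a (ξ.phi b : X) = ξ.dualForm a b := fun _ _ => rfl
  simp only [sub_eq_add_neg, dualForm_add_left, dualForm_add_right, LinearMap.add_apply,
    map_add, map_neg, map_nsmul,
    nsmul_eq_mul, hD, AddSubgroup.coe_add]
  rw [ξ.dualForm_comm u v]
  push_cast
  linarith

theorem A_le_slope {s : R} (hs : Irreducible s) {ξ : EFCDatum R K X} {l : ℕ} {α : X}
    (hα : α ∈ ξ.Sig l) (u : Module.Dual ℤ X) :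
    ξ.A l α u ≤ slope K hs (ξ.slopes l α u) := by
  refine Algebra.adjoin_le ?_
  rintro f ⟨γ, hγ, w, hf⟩
  rw [mul_mon_eq_mon_iff] at hf
  subst hf
  refine (mem_slope hs).mpr ?_
  rintro _ ⟨v, hv, rfl⟩
  exact (hasSlope_single_iff hs _ _ _).mpr (apply_le_vs_generator hα hγ hv u w)

/-- The monomial `s^{(v+u)(γ-β)} w^{γ-β}`, `γ ∈ Σ_l`, `β = α - 2lφ(v)`, is a unit of `R` times a
generator of `A_{l,α,u}`. -/
theorem smon_sub_mem_A {s : R} (hs : Irreducible s) {ξ : EFCDatum R K X} {l : ℕ} {α γ : X}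
    (hα : α ∈ ξ.Sig l) (hγ : γ ∈ ξ.Sig l) {v : Module.Dual ℤ X} (hv : v ∈ ξ.cells l α)
    (u : Module.Dual ℤ X) :
    smon K s ((v + u) (γ - (α - (2 * l) • (ξ.phi v : X)))) (γ - (α - (2 * l) • (ξ.phi v : X))) ∈
      ξ.A l α u := by
  set z := γ - (α - (2 * l) • (ξ.phi v : X)) with hz
  set c := ξ.monCoeff l γ (v + u) * (ξ.monCoeff l α u)⁻¹ with hc
  have hz' : γ + (2 * l) • (ξ.phi (v + u) : X) - (α + (2 * l) • (ξ.phi u : X)) = z := by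
    rw [hz, map_add, AddSubgroup.coe_add, smul_add]
    abel
  have hgen : AddMonoidAlgebra.single z (c : K) ∈ ξ.A l α u := by
    have hmem : AddMonoidAlgebra.single z (c : K) ∈ {f | ∃ γ ∈ ξ.Sig l, ∃ v' : Module.Dual ℤ X,
        f * ξ.mon l α u = ξ.mon l γ v'} :=
      ⟨γ, hγ, v + u, by rw [mul_mon_eq_mon_iff, hz']⟩
    exact Algebra.subset_adjoin hmem
  have hval : vs R c = (v + u) z := by rw [hc, vs_generator_eq hα γ hv u, hz']
  set t : Kˣ := Units.mk0 _ (algebraMap_ne_zero_of_irreducible (K := K) hs) with ht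
  have hunit : 0 ≤ vs R (t ^ ((v + u) z) * c⁻¹) := by
    rw [vs_mul, vs_inv, vs_zpow, vs_uniformizer hs t rfl, hval]
    simp
  obtain ⟨r, hr⟩ := (le_vs_iff hs _ _).mp hunit
  rw [zpow_zero, mul_one] at hr
  have : smon K s ((v + u) z) z = r • AddMonoidAlgebra.single z (c : K) := by
    rw [smon, AddMonoidAlgebra.smul_single, Algebra.smul_def, ← hr, ← Units.val_mul,
      inv_mul_cancel_right]
    simp [ht]
  rw [this]
  exact Subalgebra.smul_mem _ hgen r

/-- The chart `B_{l,α,u}` consists of the elements of `K[X]` whose coefficient at `w^x` is divisible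
by `s^{(v_β + u)(x)}` for all `β ∈ Σ_l^α`. -/
theorem normB_eq_slope {s : R} (hs : Irreducible s) {ξ : EFCDatum R K X} {l : ℕ} (hl : 0 < l)
    (hint : IsIntegralPolytope (ξ.voronoi l 0)) {α : X} (hα : α ∈ ξ.Sig l)
    (u : Module.Dual ℤ X) : ξ.normB l α u = slope K hs (ξ.slopes l α u) := by
  apply le_antisymm
  · intro f hf
    exact mem_slope_of_isIntegral hs (A_le_slope hs hα u) hf
  · obtain ⟨H, hH⟩ := exists_isSupportFunction (slopes_finite hl hα u) (slopes_nonempty hα u)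
    have hmon : ∀ x, smon K s (H x) x ∈ ξ.normB l α u := by
      intro x
      obtain ⟨_, ⟨v, hv, rfl⟩, hx⟩ := hH.exists_eq x
      simp only at hx
      have hcell : ∀ w ∈ ξ.cells l (α - (2 * l) • (ξ.phi v : X)), w x ≤ 0 := by
        intro w hw
        have h1 := hH.le ⟨v + w, (ξ.add_mem_cells_iff l α v w).mp hw, rfl⟩ x
        rw [← hx] at h1
        simp only [LinearMap.add_apply] at h1
        linarith
      obtain ⟨d, hd, hmem⟩ := exists_nsmul_mem_closure hl hint hv hcell
      have hcl : ∀ y ∈ AddSubmonoid.closure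
          ((fun γ => γ - (α - (2 * l) • (ξ.phi v : X))) '' ξ.Sig l),
          smon K s ((v + u) y) y ∈ ξ.A l α u := by
        intro y hy
        refine AddSubmonoid.closure_induction ?_ ?_ ?_ hy
        · rintro _ ⟨γ, hγ, rfl⟩
          exact smon_sub_mem_A hs hα hγ hv u
        · rw [map_zero, smon_zero_zero]
          exact Subalgebra.one_mem _
        · intro a b _ _ ha hb
          rw [map_add, ← smon_mul_smon hs]
          exact Subalgebra.mul_mem _ ha hb
      have hpow : smon K s (H x) x ^ d ∈ ξ.A l α u := by
        have := hcl _ hmem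
        rwa [map_nsmul, nsmul_eq_mul, hx, ← smon_pow] at this
      exact IsIntegral.of_pow hd
        (isIntegral_algebraMap (R := ξ.A l α u) (A := AddMonoidAlgebra K X) (x := ⟨_, hpow⟩))
    intro f hf
    have h1 := congrArg Subtype.val ((hH.basis hs K).linearCombination_repr ⟨f, hf⟩)
    rw [Finsupp.linearCombination_apply, Finsupp.sum, AddSubmonoidClass.coe_finsetSum] at h1
    rw [← show _ = f from h1]
    refine Subalgebra.sum_mem _ fun x _ => ?_
    rw [Subalgebra.coe_smul, hH.coe_basis]
    exact Subalgebra.smul_mem _ (hmon x) _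

theorem normB_zero {s : R} (hs : Irreducible s) {ξ : EFCDatum R K X} {l : ℕ} (hl : 0 < l)
    (hint : IsIntegralPolytope (ξ.voronoi l 0)) (u : Module.Dual ℤ X) :
    ξ.normB l 0 u = slope K hs {u} := by
  rw [normB_eq_slope hs hl hint (ξ.zero_mem_Sig l), slopes_zero hl]

/-! ### Translations of charts -/

omit [Module.Free ℤ X] [Module.Finite ℤ X] in
theorem coeff_delta (ξ : EFCDatum R K X) (v : Module.Dual ℤ X) (f : AddMonoidAlgebra K X) (x : X) :
    (ξ.delta v f).coeff x = f.coeff x * (ξ.be v x : K) := by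
  classical
  induction f using AddMonoidAlgebra.induction_linear with
  | zero => simp
  | add f g hf hg => simp [hf, hg, add_mul]
  | single y c =>
    rw [delta_single, AddMonoidAlgebra.coeff_single, AddMonoidAlgebra.coeff_single,
      Finsupp.single_apply, Finsupp.single_apply]
    split_ifs with h
    · rw [h]
    · simp

theorem hasSlope_delta {s : R} (hs : Irreducible s) (ξ : EFCDatum R K X) {n v : Module.Dual ℤ X}
    {f : AddMonoidAlgebra K X} (hf : HasSlope s n f) : HasSlope s (n + v) (ξ.delta v f) := by
  intro x
  obtain ⟨r, hr⟩ := hf x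
  obtain ⟨r', hr'⟩ := (le_vs_iff hs (ξ.be v x) (v x)).mp (ξ.vs_be v x).ge
  refine ⟨r * r', ?_⟩
  rw [coeff_delta, hr, hr', LinearMap.add_apply,
    zpow_add₀ (algebraMap_ne_zero_of_irreducible hs), map_mul]
  ring

theorem slope_le_comap_delta {s : R} (hs : Irreducible s) (ξ : EFCDatum R K X)
    (v : Module.Dual ℤ X) {V V' : Set (Module.Dual ℤ X)} (h : ∀ n ∈ V', n - v ∈ V) :
    slope K hs V ≤ (slope K hs V').comap (ξ.delta v) := by
  intro f hf
  rw [Subalgebra.mem_comap, mem_slope]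
  intro n hn
  have := ξ.hasSlope_delta hs (v := v) ((mem_slope hs).mp hf _ (h n hn))
  rwa [sub_add_cancel] at this

omit [Module.Free ℤ X] [Module.Finite ℤ X] in
theorem delta_delta_neg (ξ : EFCDatum R K X) (v : Module.Dual ℤ X) (f : AddMonoidAlgebra K X) :
    ξ.delta v (ξ.delta (-v) f) = f := by
  ext x
  have h0 : ξ.be 0 x = 1 := by simpa using ξ.be_add_left 0 0 x
  have h1 := ξ.be_add_left (-v) v x
  rw [neg_add_cancel, h0] at h1
  rw [coeff_delta, coeff_delta, mul_assoc, ← Units.val_mul, ← h1, Units.val_one, mul_one]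

/-! ### Generators and relations of the closed fibre -/

/-- A lattice point lies in the local cone at `β` iff the slope `v_β + u` is maximal there. -/
theorem toXR_mem_cone_iff_eq {ξ : EFCDatum R K X} {l : ℕ} (hl : 0 < l)
    (hint : IsIntegralPolytope (ξ.voronoi l 0)) {α : X} {u v : Module.Dual ℤ X}
    (hv : v ∈ ξ.cells l α) {H : X → ℤ} (hH : IsSupportFunction (ξ.slopes l α u) H) (x : X) :
    toXR x ∈ ξ.cone l (α - (2 * l) • (ξ.phi v : X)) ↔ (v + u) x = H x := by
  rw [toXR_mem_cone_iff hl hint hv]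
  constructor
  · intro h
    refine le_antisymm (hH.le ⟨v, hv, rfl⟩ x) ?_
    obtain ⟨_, ⟨w, hw, rfl⟩, hx⟩ := hH.exists_eq x
    have h1 := h (w - v) ((ξ.add_mem_cells_iff l α v _).mpr (by rwa [add_sub_cancel]))
    rw [← hx]
    simp only [LinearMap.add_apply, LinearMap.sub_apply] at h1 ⊢
    linarith
  · intro h w hw
    have h1 := hH.le ⟨v + w, (ξ.add_mem_cells_iff l α v w).mp hw, rfl⟩ x
    rw [← h] at h1
    simp only [LinearMap.add_apply] at h1
    linarith

omit [Module.Free ℤ X] [Module.Finite ℤ X] in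
theorem exists_cells_of_mem_SigAt {ξ : EFCDatum R K X} {l : ℕ} {α β : X} (hβ : β ∈ ξ.SigAt l α) :
    ∃ v ∈ ξ.cells l α, β = α - (2 * l) • (ξ.phi v : X) := by
  obtain ⟨⟨v, hv⟩, hβ⟩ := hβ
  have h : β = α - (2 * l) • (ξ.phi (-v) : X) := by
    rw [hv, map_neg, AddSubgroup.coe_neg, smul_neg, sub_neg_eq_add]
  refine ⟨-v, ?_, h⟩
  rw [h] at hβ
  exact hβ

omit [Module.Free ℤ X] [Module.Finite ℤ X] in
theorem mem_SigAt_of_mem_cells {ξ : EFCDatum R K X} {l : ℕ} {α : X} {v : Module.Dual ℤ X}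
    (hv : v ∈ ξ.cells l α) : α - (2 * l) • (ξ.phi v : X) ∈ ξ.SigAt l α :=
  ⟨⟨-v, by rw [map_neg, AddSubgroup.coe_neg, smul_neg, sub_eq_add_neg]⟩, hv⟩

section Presentation

variable {ξ : EFCDatum R K X} {l : ℕ} {α : X} {u : Module.Dual ℤ X} {H : X → ℤ}

omit [Module.Free ℤ X] [Module.Finite ℤ X] in
theorem ConePoint.v_mem_cells (p : ξ.ConePoint l α) : p.v ∈ ξ.cells l α :=
  show α - _ ∈ _ from p.β_eq ▸ p.β_mem.2

theorem ConePoint.apply_eq (hl : 0 < l) (hint : IsIntegralPolytope (ξ.voronoi l 0))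
    (hH : IsSupportFunction (ξ.slopes l α u) H) (p : ξ.ConePoint l α) :
    (p.v + u) p.x = H p.x :=
  (toXR_mem_cone_iff_eq hl hint p.v_mem_cells hH p.x).mp (p.β_eq ▸ p.x_mem)

theorem ConePoint.common_iff (hl : 0 < l) (hint : IsIntegralPolytope (ξ.voronoi l 0))
    (hH : IsSupportFunction (ξ.slopes l α u) H) (p q : ξ.ConePoint l α) :
    p.Common q ↔ H (p.x + q.x) = H p.x + H q.x := by
  rw [hH.map_add_eq_iff]
  constructor
  · rintro ⟨β, hβ, hp, hq⟩
    obtain ⟨v, hv, rfl⟩ := exists_cells_of_mem_SigAt hβ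
    exact ⟨v + u, ⟨v, hv, rfl⟩, (toXR_mem_cone_iff_eq hl hint hv hH _).mp hp,
      (toXR_mem_cone_iff_eq hl hint hv hH _).mp hq⟩
  · rintro ⟨_, ⟨v, hv, rfl⟩, hp, hq⟩
    exact ⟨_, mem_SigAt_of_mem_cells hv, (toXR_mem_cone_iff_eq hl hint hv hH _).mpr hp,
      (toXR_mem_cone_iff_eq hl hint hv hH _).mpr hq⟩

theorem exists_conePoint (hl : 0 < l) (hint : IsIntegralPolytope (ξ.voronoi l 0))
    (hH : IsSupportFunction (ξ.slopes l α u) H) (x : X) : ∃ p : ξ.ConePoint l α, p.x = x := by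
  obtain ⟨_, ⟨v, hv, rfl⟩, hx⟩ := hH.exists_eq x
  exact ⟨⟨_, mem_SigAt_of_mem_cells hv, v, rfl, x,
    (toXR_mem_cone_iff_eq hl hint hv hH _).mpr hx⟩, rfl⟩

omit [Module.Free ℤ X] [Module.Finite ℤ X] in
theorem ConePoint.exists_isSum {p q : ξ.ConePoint l α} (h : p.Common q) :
    ∃ r : ξ.ConePoint l α, p.IsSum q r := by
  obtain ⟨β, hβ, hp, hq⟩ := h
  obtain ⟨v, hv, h⟩ := exists_cells_of_mem_SigAt hβ
  exact ⟨⟨β, hβ, v, h, p.x + q.x, by rw [toXR_add]; exact Submodule.add_mem _ hp hq⟩, hp, hq, rfl⟩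

omit [Module.Free ℤ X] [Module.Finite ℤ X] in
theorem ConePoint.IsSum.common {p q r : ξ.ConePoint l α} (h : p.IsSum q r) : p.Common q :=
  ⟨r.β, r.β_mem, h.1, h.2.1⟩

omit [Module.Free ℤ X] [Module.Finite ℤ X] in
/-- Modulo the relations, a variable only depends on the lattice point and not on the cone: multiply
it by the variable at `0` in the other cone, which is congruent to `1`. -/
theorem X_sub_X_mem_relations {p r : ξ.ConePoint l α} (h : p.x = r.x) :
    (MvPolynomial.X p - MvPolynomial.X r :
      MvPolynomial (ξ.ConePoint l α) (IsLocalRing.ResidueField R)) ∈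
      Ideal.span (ξ.relations l α) := by
  have h0 : toXR (0 : X) ∈ ξ.cone l r.β := by
    rw [toXR_zero]
    exact Submodule.zero_mem _
  let o : ξ.ConePoint l α := ⟨r.β, r.β_mem, r.v, r.β_eq, 0, h0⟩
  have h1 : (MvPolynomial.X p * MvPolynomial.X o - MvPolynomial.X r :
      MvPolynomial (ξ.ConePoint l α) (IsLocalRing.ResidueField R)) ∈
      Ideal.span (ξ.relations l α) :=
    Ideal.subset_span (Or.inl (Or.inl ⟨p, o, r,
      ⟨h ▸ r.x_mem, h0, (h.symm.trans (add_zero _).symm)⟩, rfl⟩))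
  have h2 : (MvPolynomial.X o - 1 :
      MvPolynomial (ξ.ConePoint l α) (IsLocalRing.ResidueField R)) ∈
      Ideal.span (ξ.relations l α) :=
    Ideal.subset_span (Or.inr ⟨o, rfl, rfl⟩)
  convert Ideal.sub_mem _ h1 (Ideal.mul_mem_left _ (MvPolynomial.X p) h2) using 1
  ring

theorem ker_aeval_eq_span_relations (hl : 0 < l) (hint : IsIntegralPolytope (ξ.voronoi l 0))
    {s : R} (hs : Irreducible s) (hH : IsSupportFunction (ξ.slopes l α u) H) :
    RingHom.ker (MvPolynomial.aeval (R := IsLocalRing.ResidueField R)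
      fun p : ξ.ConePoint l α => hH.fibreBasis hs K p.x) = Ideal.span (ξ.relations l α) := by
  choose sec hsec using exists_conePoint hl hint hH
  refine ker_aeval_eq_of_mul_mem (hH.fibreBasis hs K) (fun p : ξ.ConePoint l α => p.x) sec
    (hH.fibreBasis_zero hs) _ ?_ ?_ ?_
  · rw [Ideal.span_le]
    rintro f ((⟨p, q, r, hpqr, rfl⟩ | ⟨p, q, hpq, rfl⟩) | ⟨p, hp, rfl⟩)
    · simp only [SetLike.mem_coe, RingHom.mem_ker, map_sub, map_mul, MvPolynomial.aeval_X]
      rw [hH.fibreBasis_mul hs, if_pos ((p.common_iff hl hint hH q).mp hpqr.common), hpqr.2.2,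
        sub_self]
    · simp only [SetLike.mem_coe, RingHom.mem_ker, map_mul, MvPolynomial.aeval_X]
      rw [hH.fibreBasis_mul hs, if_neg (fun h => hpq ((p.common_iff hl hint hH q).mpr h))]
    · simp only [SetLike.mem_coe, RingHom.mem_ker, map_sub, map_one, MvPolynomial.aeval_X]
      rw [hp, hH.fibreBasis_zero hs, sub_self]
  · exact Ideal.subset_span (Or.inr ⟨sec 0, hsec 0, rfl⟩)
  · intro x p
    have hc := (sec x).common_iff hl hint hH p
    rw [hsec] at hc
    rw [hH.fibreBasis_mul hs]
    split_ifs with h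
    · rw [Module.Basis.constr_basis]
      obtain ⟨r, hr⟩ := ConePoint.exists_isSum (hc.mpr h)
      have h1 : (MvPolynomial.X (sec x) * MvPolynomial.X p - MvPolynomial.X r :
          MvPolynomial (ξ.ConePoint l α) (IsLocalRing.ResidueField R)) ∈
          Ideal.span (ξ.relations l α) :=
        Ideal.subset_span (Or.inl (Or.inl ⟨_, _, _, hr, rfl⟩))
      have h2 := X_sub_X_mem_relations (R := R) (p := r) (r := sec (x + p.x))
        (by rw [hr.2.2, hsec, hsec])
      convert Ideal.add_mem _ h1 h2 using 1
      ring
    · rw [map_zero, sub_zero]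
      exact Ideal.subset_span (Or.inl (Or.inr ⟨_, _, fun h' => h (hc.mp h'), rfl⟩))

/-- The structure of the closed fibre of a chart: all assertions are read off from the monomial
basis and its multiplication table. -/
theorem exists_fibre_presentation (hl : 0 < l) (hint : IsIntegralPolytope (ξ.voronoi l 0))
    {s : R} (hs : Irreducible s) (hα : α ∈ ξ.Sig l) (u : Module.Dual ℤ X)
    (A : Subalgebra R (AddMonoidAlgebra K X)) (hA : A = slope K hs (ξ.slopes l α u)) :
    ∃ m : ξ.ConePoint l α → A,
      (∀ p, (m p : AddMonoidAlgebra K X) = smon K s ((p.v + u) p.x) p.x) ∧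
      Algebra.adjoin (IsLocalRing.ResidueField R)
          {f : IsLocalRing.ResidueField R ⊗[R] A | ∃ p, f = 1 ⊗ₜ[R] m p} = ⊤ ∧
      RingHom.ker (MvPolynomial.aeval (R := IsLocalRing.ResidueField R)
          (fun p => (1 : IsLocalRing.ResidueField R) ⊗ₜ[R] m p)) =
        Ideal.span (ξ.relations l α) ∧
      (∀ p q r, p.IsSum q r →
        ((1 : IsLocalRing.ResidueField R) ⊗ₜ[R] m p) * (1 ⊗ₜ[R] m q) = 1 ⊗ₜ[R] m r) ∧
      (∀ p q, ¬ p.Common q →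
        ((1 : IsLocalRing.ResidueField R) ⊗ₜ[R] m p) * (1 ⊗ₜ[R] m q) = 0) ∧
      (∀ p q, ((1 : IsLocalRing.ResidueField R) ⊗ₜ[R] m p) * (1 ⊗ₜ[R] m q) ≠ 0 ↔
        p.Common q) := by
  subst hA
  obtain ⟨H, hH⟩ := exists_isSupportFunction (slopes_finite hl hα u) (slopes_nonempty hα u)
  refine ⟨fun p => hH.basis hs K p.x, fun p => ?_, ?_, ?_, ?_, ?_, ?_⟩
  · rw [hH.coe_basis, p.apply_eq hl hint hH]
  · rw [← top_le_iff]
    intro z _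
    refine Submodule.span_induction ?_ (Subalgebra.zero_mem _)
      (fun _ _ _ _ ha hb => Subalgebra.add_mem _ ha hb)
      (fun c _ _ ha => Subalgebra.smul_mem _ ha c) ((hH.fibreBasis hs K).mem_span z)
    rintro _ ⟨x, rfl⟩
    obtain ⟨p, hp⟩ := exists_conePoint hl hint hH x
    refine Algebra.subset_adjoin ⟨p, ?_⟩
    rw [← hp, hH.fibreBasis_apply]
  all_goals simp only [← hH.fibreBasis_apply hs]
  · exact ker_aeval_eq_span_relations hl hint hs hH
  · intro p q r h
    rw [hH.fibreBasis_mul hs, if_pos ((p.common_iff hl hint hH q).mp h.common), h.2.2]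
  · intro p q h
    rw [hH.fibreBasis_mul hs, if_neg (fun h' => h ((p.common_iff hl hint hH q).mpr h'))]
  · intro p q
    rw [hH.fibreBasis_mul hs, p.common_iff hl hint hH]
    split_ifs with h
    · exact iff_of_true ((hH.fibreBasis hs K).ne_zero _) h
    · exact iff_of_false (fun h' => h' rfl) h

end Presentation

end EFCDatum

/-! ### The three assertions about the charts -/

/-- An isomorphism of `R`-algebras gives an isomorphism of the spectra over `Spec R`. -/
noncomputable def specOverIso {R A B : Type u} [CommRing R] [CommRing A] [CommRing B] [Algebra R A]
    [Algebra R B] (e : A ≃ₐ[R] B) : specOver R A ≅ specOver R B :=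
  Over.isoMk (Scheme.Spec.mapIso e.symm.toRingEquiv.toCommRingCatIso.op) (by
    change Spec.map _ ≫ Spec.map _ = Spec.map _
    rw [← Spec.map_comp]
    congr 1
    ext r
    exact e.symm.commutes r)

/-- The chart `W_{l,0,v+u}`, `v = v_β`, is the localization of `W_{l,α,u}` at a monomial, and `δ_{-v}`
carries the pair `W_{l,0,u} ⊆ W_{l,β,u}` to the pair `W_{l,0,v+u} ⊆ W_{l,α,u}`. -/
theorem EFCDatum.exists_openImmersion_of_mem_cells {R K X : Type u} [CommRing R] [IsDomain R]
    [IsDiscreteValuationRing R] [Field K] [Algebra R K] [IsFractionRing R K] [AddCommGroup X]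
    [Module.Free ℤ X] [Module.Finite ℤ X] {ξ : EFCDatum R K X} {l : ℕ} (hl : 0 < l)
    (hint : IsIntegralPolytope (ξ.voronoi l 0)) {s : R} (hs : Irreducible s) {α : X}
    (hα : α ∈ ξ.Sig l) {v : Module.Dual ℤ X} (hv : v ∈ ξ.cells l α) (u : Module.Dual ℤ X) :
    ∃ (h : ξ.normB l α u ≤ ξ.normB l 0 (v + u))
      (h' : ξ.normB l (α - (2 * l) • (ξ.phi v : X)) u ≤ ξ.normB l 0 u)
      (hδ : ξ.normB l α u ≤
        (ξ.normB l (α - (2 * l) • (ξ.phi v : X)) u).comap (ξ.delta (-v))),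
      IsOpenImmersion (specIncl h).left ∧ IsOpenImmersion (fibreIncl h) ∧
      Set.range (fibreIncl h) = closedFibreMap (ξ.delta (-v)) hδ '' Set.range (fibreIncl h') := by
  have hβ : α - (2 * l) • (ξ.phi v : X) ∈ ξ.Sig l := hv
  rw [normB_eq_slope hs hl hint hα, normB_eq_slope hs hl hint hβ, normB_zero hs hl hint,
    normB_zero hs hl hint]
  have hmem : v + u ∈ ξ.slopes l α u := ⟨v, hv, rfl⟩
  have h : slope K hs (ξ.slopes l α u) ≤ slope K hs {v + u} :=
    slope_anti hs (Set.singleton_subset_iff.mpr hmem)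
  have hlt := lt_of_mem_slopes hl u hv
  refine ⟨h, slope_anti hs (Set.singleton_subset_iff.mpr ⟨0, zero_mem_cells hβ, zero_add u⟩),
    ξ.slope_le_comap_delta hs (-v) ?_,
    isOpenImmersion_specIncl hs (slopes_finite hl hα u) hlt h,
    isOpenImmersion_fibreIncl hs (slopes_finite hl hα u) hmem hlt h,
    range_fibreIncl_eq_image _ _ _ (ξ.delta v) _ (ξ.slope_le_comap_delta hs (-v) ?_)
      (ξ.slope_le_comap_delta hs v ?_) (ξ.delta_delta_neg v)⟩
  · rw [slopes_sub]
    rintro _ ⟨n, hn, rfl⟩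
    simpa using hn
  · rintro n rfl
    rw [sub_neg_eq_add, add_comm]
    rfl
  · rintro n rfl
    rw [add_sub_cancel_left]
    rfl

end NeronModel

theorem theorem7p8 {R K X : Type u} [CommRing R] [IsDomain R] [IsDiscreteValuationRing R]
    [IsAdicComplete (IsLocalRing.maximalIdeal R) R]
    [Field K] [Algebra R K] [IsFractionRing R K]
    [AddCommGroup X] [Module.Free ℤ X] [Module.Finite ℤ X]
    (s : R) (hs : Irreducible s)
    (ξ : NeronModel.EFCDatum R K X) (hexact : ξ.toFCDatum.IsExact)
    (l : ℕ) (hl : 0 < l)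
    (hint : NeronModel.IsIntegralPolytope (ξ.voronoi l 0))
    (α : X) (hα : α ∈ ξ.Sig l) (u : Module.Dual ℤ X) :
    -- the interior case; equality of charts is equality of subrings of `K[X]`
    (NeronModel.toXR α ∈ intrinsicInterior ℝ (ξ.voronoi l 0) →
      ξ.normB l α u = ξ.normB l 0 u ∧
      ξ.normB l α u = Algebra.adjoin R {f | ∃ x : X, f = NeronModel.smon K s (u x) x} ∧
      ξ.W l α u = ξ.W l 0 u ∧
      ξ.W l α u = NeronModel.specOver R
        (Algebra.adjoin R {f | ∃ x : X, f = NeronModel.smon K s (u x) x}) ∧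
      Nonempty (ξ.W l α u ≅ NeronModel.torus R X)) ∧
    -- the boundary case
    (NeronModel.toXR α ∈ intrinsicFrontier ℝ (ξ.voronoi l 0) →
      -- `W_{l,0,v+u}` is an open subscheme of `W_{l,α,u}`, and its closed fibre is the translate
      -- by `δ_{-v} : (W_{l,β,u})_0 → (W_{l,α,u})_0` of `(W_{l,0,u})_0`
      (∀ β ∈ ξ.SigAt l α, ∀ v : Module.Dual ℤ X, β = α - (2 * l) • (ξ.phi v : X) →
        ∃ (h : ξ.normB l α u ≤ ξ.normB l 0 (v + u))
          (h' : ξ.normB l β u ≤ ξ.normB l 0 u)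
          (hδ : ξ.normB l α u ≤ (ξ.normB l β u).comap (ξ.delta (-v))),
          AlgebraicGeometry.IsOpenImmersion (NeronModel.specIncl h).left ∧
          AlgebraicGeometry.IsOpenImmersion (NeronModel.fibreIncl h) ∧
          Set.range (NeronModel.fibreIncl h) =
            NeronModel.closedFibreMap (ξ.delta (-v)) hδ ''
              Set.range (NeronModel.fibreIncl h')) ∧
      -- the irreducible components of `(W_{l,α,u})_0` are exactly the closures of these
      irreducibleComponents (NeronModel.closedFibre (ξ.normB l α u)) =
        {Z | ∃ β ∈ ξ.SigAt l α, ∃ v : Module.Dual ℤ X, β = α - (2 * l) • (ξ.phi v : X) ∧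
          ∃ h : ξ.normB l α u ≤ ξ.normB l 0 (v + u),
            Z = closure (Set.range (NeronModel.fibreIncl h))} ∧
      -- the structure of the ring `B_{l,α,u} ⊗ k(0)`
      ∃ m : ξ.ConePoint l α → ξ.normB l α u,
        (∀ p, (m p : AddMonoidAlgebra K X) = NeronModel.smon K s ((p.v + u) p.x) p.x) ∧
        Algebra.adjoin (IsLocalRing.ResidueField R)
            {f : IsLocalRing.ResidueField R ⊗[R] ξ.normB l α u | ∃ p, f = 1 ⊗ₜ[R] m p} = ⊤ ∧
        RingHom.ker (MvPolynomial.aeval (R := IsLocalRing.ResidueField R)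
            (fun p => (1 : IsLocalRing.ResidueField R) ⊗ₜ[R] m p)) =
          Ideal.span (ξ.relations l α) ∧
        (∀ p q r, p.IsSum q r →
          ((1 : IsLocalRing.ResidueField R) ⊗ₜ[R] m p) * (1 ⊗ₜ[R] m q) = 1 ⊗ₜ[R] m r) ∧
        (∀ p q, ¬ p.Common q →
          ((1 : IsLocalRing.ResidueField R) ⊗ₜ[R] m p) * (1 ⊗ₜ[R] m q) = 0) ∧
        (∀ p q, ((1 : IsLocalRing.ResidueField R) ⊗ₜ[R] m p) * (1 ⊗ₜ[R] m q) ≠ 0 ↔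
          p.Common q)) := by
  refine ⟨fun hint' => ?_, fun _ => ⟨?_, ?_, ?_⟩⟩
  · have hcells := NeronModel.EFCDatum.cells_eq_of_mem_intrinsicInterior hl hint hα hint'
    have h1 : ξ.normB l α u = NeronModel.slope K hs {u} := by
      rw [NeronModel.EFCDatum.normB_eq_slope hs hl hint hα, NeronModel.EFCDatum.slopes, hcells,
        Set.image_singleton, zero_add]
    have h2 : ξ.normB l 0 u = NeronModel.slope K hs {u} :=
      NeronModel.EFCDatum.normB_zero hs hl hint u
    have h3 := NeronModel.adjoin_smon_eq_slope (K := K) hs u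
    refine ⟨h1.trans h2.symm, h1.trans h3.symm, ?_, ?_, ?_⟩
    · rw [NeronModel.EFCDatum.W, NeronModel.EFCDatum.W, h1, h2]
    · rw [NeronModel.EFCDatum.W, h1, h3]
    · rw [NeronModel.EFCDatum.W, h1, NeronModel.slope_singleton]
      exact ⟨(NeronModel.specOverIso
        (AlgEquiv.ofInjective _ (NeronModel.twist_injective hs u))).symm⟩
  · rintro β hβ v rfl
    have hv : v ∈ ξ.cells l α := hβ.2
    exact NeronModel.EFCDatum.exists_openImmersion_of_mem_cells hl hint hs hα hv u
  · rw [NeronModel.irreducibleComponents_closedFibre_slope hs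
      (NeronModel.EFCDatum.slopes_finite hl hα u) (NeronModel.EFCDatum.slopes_nonempty hα u)
      ?_ _ (NeronModel.EFCDatum.normB_eq_slope hs hl hint hα u) (fun n => ξ.normB l 0 n)
      (fun n _ => NeronModel.EFCDatum.normB_zero hs hl hint n)]
    · ext Z
      constructor
      · rintro ⟨_, ⟨v, hv, rfl⟩, hZ⟩
        exact ⟨_, NeronModel.EFCDatum.mem_SigAt_of_mem_cells hv, v, rfl, hZ⟩
      · rintro ⟨β, hβ, v, rfl, hZ⟩
        exact ⟨v + u, ⟨v, hβ.2, rfl⟩, hZ⟩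
    · rintro _ ⟨v, hv, rfl⟩
      exact ⟨_, NeronModel.EFCDatum.lt_of_mem_slopes hl u hv⟩
  · exact NeronModel.EFCDatum.exists_fibre_presentation hl hint hs hα u _
      (NeronModel.EFCDatum.normB_eq_slope hs hl hint hα u)
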